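/- **Theorem (Weil).** Let $M$ be a smooth ($C^\infty$) finite-dimensional manifold without boundary, Hausdorff and second countable, let $\Omega$ be a symplectic form on $M$ (a smooth, closed, non-degenerate real $2$-form), and let $\hbar>0$. A *prequantization* of $(M,\Omega)$ is a triple $(L,h,\nabla)$ consisting of a smooth complex line bundle $L\to M$, a smooth hermitian (positive definite) metric $h$ on $L$, and a connection $\nabla$ on $L$ which is compatible with $h$, i.e. $X(h(s,t))=h(\nabla_Xs,t)+h(s,\nabla_Xt)$ for all real vector fields $X$ and smooth sections $s,t$, and whose curvature form is $\operatorname{curv}\nabla=\frac{\Omega}{2\pi\hbar}$. Here the curvature form is the $2$-form given locally by $d\omega$, where $\nabla s=2\pi i\,\omega\otimes s$ for a nowhere vanishing local section $s$. The system $(M,\Omega)$ is *prequantizable* if it has a prequantization. A class in the de Rham cohomology $H^2(M,\mathbb R)$ is *integral* if the corresponding class in Čech cohomology $\check H^2(M,\mathbb R)$ lies in the image of the map $\check H^2(M,\mathbb Z)\to\check H^2(M,\mathbb R)$ induced by the inclusion $\mathbb Z\hookrightarrow\mathbb R$. The correspondence sends $[\Theta]$ to the class of the cocycle $a_{ljk}=f_{lj}+f_{jk}-f_{lk}$,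 where $\{U_l\}$ is an open covering of $M$ with smooth $1$-forms $\omega_l$ on $U_l$ and smooth functions $f_{lj}$ on $U_l\cap U_j$ such that $d\omega_l=\Theta|_{U_l}$ and $\omega_j-\omega_l=df_{lj}$. 1. $(M,\Omega)$ is prequantizable if and only if the class $\left[\frac{\Omega}{2\pi\hbar}\right]\in H^2(M,\mathbb R)$ is integral. 2. If $M$ is simply connected, then any two prequantizations $(L,h,\nabla)$ and $(L',h',\nabla')$ of $(M,\Omega)$ are equivalent: there is a diffeomorphism $\phi\colon L\to L'$ covering the identity of $M$ and complex linear on the fibres, such that $h=\phi^*h'$ and $\nabla'_X(\phi\circ s)=\phi\circ\nabla_Xs$ for all vector fields $X$ and smooth sections $s$ of $L$. -/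

import Mathlib

open Bundle Manifold TopologicalSpace
open scoped ContDiff

noncomputable section

namespace Prequantum

/-! ### Differential forms on a manifold

`M` is a smooth manifold without boundary, modelled on a finite-dimensional real normed
space `E`. -/

section Forms

variable (E : Type*) [NormedAddCommGroup E] [NormedSpace ℝ E]
  (M : Type*) [TopologicalSpace M] [ChartedSpace E M]
  (F : Type*) [NormedAddCommGroup F] [NormedSpace ℝ F]

/-- A (not necessarily smooth) differential `p`-form on `M` with values in `F`. -/
def Form (p : ℕ) : Type _ :=
  ∀ x : M, TangentSpace 𝓘(ℝ, E) x [⋀^Fin p]→L[ℝ] F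

instance (p : ℕ) : AddCommGroup (Form E M F p) :=
  inferInstanceAs (AddCommGroup (∀ x : M, TangentSpace 𝓘(ℝ, E) x [⋀^Fin p]→L[ℝ] F))

instance (p : ℕ) : Module ℝ (Form E M F p) :=
  inferInstanceAs (Module ℝ (∀ x : M, TangentSpace 𝓘(ℝ, E) x [⋀^Fin p]→L[ℝ] F))

variable {E M F}

/-- The form `α` read in the preferred chart `φ` at `x₀`, i.e. the pullback `(φ⁻¹)^* α`. It is
meaningful on the target of `φ`. -/
def Form.inChart {p : ℕ} (α : Form E M F p) (x₀ : M) : E → E [⋀^Fin p]→L[ℝ] F := fun y =>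
  (α ((chartAt E x₀).symm y)).compContinuousLinearMap
    (mfderiv 𝓘(ℝ, E) 𝓘(ℝ, E) (chartAt E x₀).symm y :
      E →L[ℝ] TangentSpace 𝓘(ℝ, E) ((chartAt E x₀).symm y))

/-- `α` is smooth on the open set `U`: its coefficients in every preferred chart are smooth. -/
def Form.SmoothOn {p : ℕ} (α : Form E M F p) (U : Opens M) : Prop :=
  ∀ x₀ : M, ContDiffOn ℝ ∞ (α.inChart x₀)
    ((chartAt E x₀).target ∩ (chartAt E x₀).symm ⁻¹' (U : Set M))

/-- The exterior derivative: `(dα)_x = φ^* (d ((φ⁻¹)^* α))` at `x`, with `φ` the preferred chart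
at `x`. It depends only on the germ of `α` at `x`. -/
def Form.d {p : ℕ} (α : Form E M F p) : Form E M F (p + 1) := fun x =>
  (extDeriv (α.inChart x) (chartAt E x x)).compContinuousLinearMap
    (mfderiv 𝓘(ℝ, E) 𝓘(ℝ, E) (chartAt E x) x : TangentSpace 𝓘(ℝ, E) x →L[ℝ] E)

theorem Form.inChart_add {p : ℕ} (α η : Form E M F p) (x₀ : M) :
    (α + η).inChart x₀ = α.inChart x₀ + η.inChart x₀ := by
  rfl

theorem Form.inChart_smul {p : ℕ} (c : ℝ) (α : Form E M F p) (x₀ : M) :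
    (c • α).inChart x₀ = c • α.inChart x₀ := by
  rfl

theorem Form.SmoothOn.differentiableAt {p : ℕ} {α : Form E M F p} (h : α.SmoothOn ⊤) (x : M) :
    DifferentiableAt ℝ (α.inChart x) (chartAt E x x) := by
  have h1 := h x
  simp only [Opens.coe_top, Set.preimage_univ, Set.inter_univ] at h1
  exact (h1.contDiffAt ((chartAt E x).open_target.mem_nhds
    (mem_chart_target E x))).differentiableAt (by simp)

theorem Form.d_add {p : ℕ} {α η : Form E M F p} (hα : α.SmoothOn ⊤) (hη : η.SmoothOn ⊤) :
    (α + η).d = α.d + η.d := by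
  funext x
  simp only [Form.d, Form.inChart_add,
    extDeriv_add (hα.differentiableAt x) (hη.differentiableAt x)]
  rfl

theorem Form.d_smul {p : ℕ} (c : ℝ) (α : Form E M F p) : (c • α).d = c • α.d := by
  funext x
  simp only [Form.d, Form.inChart_smul, extDeriv_smul]
  rfl

variable (E M)

/-- The space of smooth real `p`-forms on `M`. -/
def smoothForms (p : ℕ) : Submodule ℝ (Form E M ℝ p) where
  carrier := {α | α.SmoothOn ⊤}
  add_mem' := fun hα hη x₀ => by
    rw [Form.inChart_add]; exact (hα x₀).add (hη x₀)
  zero_mem' := fun x₀ => by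
    have h : (0 : Form E M ℝ p).inChart x₀ = fun _ => 0 := by
      rfl
    rw [h]; exact contDiffOn_const
  smul_mem' := fun c α hα x₀ => by
    rw [Form.inChart_smul]; exact (hα x₀).const_smul c

/-- The exterior derivative on smooth real forms, as a linear map. -/
def smoothD (p : ℕ) : smoothForms E M p →ₗ[ℝ] Form E M ℝ (p + 1) where
  toFun α := (α : Form E M ℝ p).d
  map_add' α η := Form.d_add α.2 η.2
  map_smul' c _ := Form.d_smul c _

/-- The closed smooth real `p`-forms. -/
def closedForms (p : ℕ) : Submodule ℝ (smoothForms E M p) := LinearMap.ker (smoothD E M p)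

/-- The exact `(p+1)`-forms: exterior derivatives of smooth real `p`-forms. -/
def exactForms (p : ℕ) : Submodule ℝ (Form E M ℝ (p + 1)) := LinearMap.range (smoothD E M p)

/-- de Rham cohomology `H^{p+1}(M, ℝ)`: closed `(p+1)`-forms modulo exact ones. -/
abbrev DeRham (p : ℕ) : Type _ :=
  closedForms E M (p + 1) ⧸
    (exactForms E M p).comap ((smoothForms E M (p + 1)).subtype ∘ₗ (closedForms E M (p + 1)).subtype)

/-- A symplectic form: a smooth, closed, non-degenerate real 2-form. -/
structure SymplecticForm where
  form : Form E M ℝ 2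
  smooth : form.SmoothOn ⊤
  closed : form.d = 0
  nondegenerate : ∀ (x : M) (v : TangentSpace 𝓘(ℝ, E) x),
    (∀ w : TangentSpace 𝓘(ℝ, E) x, form x ![v, w] = 0) → v = 0

variable {E M}

/-- A symplectic form as an element of the space of closed smooth 2-forms. -/
def SymplecticForm.toClosed (Ω : SymplecticForm E M) : closedForms E M 2 :=
  ⟨⟨Ω.form, Ω.smooth⟩, Ω.closed⟩

/-- The closed 2-form `Ω / 2πħ`. -/
def SymplecticForm.scaled (Ω : SymplecticForm E M) (hbar : ℝ) : closedForms E M 2 :=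
  (2 * Real.pi * hbar)⁻¹ • Ω.toClosed

/-- The de Rham class `[Ω / 2πħ] ∈ H²(M, ℝ)`. -/
def SymplecticForm.scaledClass (Ω : SymplecticForm E M) (hbar : ℝ) : DeRham E M 1 :=
  Submodule.Quotient.mk (Ω.scaled hbar)

end Forms

/-! ### Čech cohomology with constant coefficients -/

section Cech

/-- An open covering of `M` indexed by the points of `M`, the point `x` lying in the member with
index `x`. Every open covering is refined by one of these, so they are cofinal among all open
coverings and compute the same direct limit; they have canonical refinement maps. -/
structure Cover (M : Type*) [TopologicalSpace M] where
  U : M → Opens M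
  mem : ∀ x, x ∈ U x

variable {M : Type*} [TopologicalSpace M]

/-- `𝒰 ≤ 𝒱` means that `𝒱` refines `𝒰`. -/
instance : Preorder (Cover M) where
  le 𝒰 𝒱 := ∀ x, 𝒱.U x ≤ 𝒰.U x
  le_refl _ _ := le_rfl
  le_trans _ _ _ h h' x := (h' x).trans (h x)

instance : Nonempty (Cover M) := ⟨⟨fun _ => ⊤, fun _ => trivial⟩⟩

instance : IsDirectedOrder (Cover M) :=
  ⟨fun 𝒰 𝒱 => ⟨⟨fun x => 𝒰.U x ⊓ 𝒱.U x, fun x => ⟨𝒰.mem x, 𝒱.mem x⟩⟩,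
    fun _ => inf_le_left, fun _ => inf_le_right⟩⟩

/-- The intersection `U_{σ 0} ∩ ⋯ ∩ U_{σ p}`. -/
def Cover.inter (𝒰 : Cover M) {p : ℕ} (σ : Fin (p + 1) → M) : Set M :=
  {y | ∀ i, y ∈ 𝒰.U (σ i)}

variable (A : Type*) [AddCommGroup A]

/-- Čech `p`-cochains of a covering with coefficients in the constant sheaf `A`, whose sections
are the locally constant functions. -/
abbrev Cochain (𝒰 : Cover M) (p : ℕ) : Type _ :=
  ∀ σ : Fin (p + 1) → M, LocallyConstant (𝒰.inter σ) A

/-- The inclusion `U_{σ 0} ∩ ⋯ ∩ U_{σ (p+1)} → U_{σ 0} ∩ ⋯ (omit σ k) ⋯ ∩ U_{σ (p+1)}`. -/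
def Cover.face (𝒰 : Cover M) {p : ℕ} (σ : Fin (p + 2) → M) (k : Fin (p + 2)) :
    C(𝒰.inter σ, 𝒰.inter (σ ∘ k.succAbove)) :=
  ⟨Set.inclusion (show 𝒰.inter σ ⊆ 𝒰.inter (σ ∘ k.succAbove) from
    fun _ hy i => hy (k.succAbove i)), continuous_inclusion _⟩

/-- The inclusion of an intersection of members of a refinement. -/
def Cover.inclusion {𝒰 𝒱 : Cover M} (h : 𝒰 ≤ 𝒱) {p : ℕ} (σ : Fin (p + 1) → M) :
    C(𝒱.inter σ, 𝒰.inter σ) :=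
  ⟨Set.inclusion (show 𝒱.inter σ ⊆ 𝒰.inter σ from fun _ hy i => h (σ i) (hy i)),
    continuous_inclusion _⟩

/-- The Čech differential `(δc)_{i₀…i_{p+1}} = ∑ₖ (-1)^k c_{i₀…î_k…i_{p+1}}`. -/
def delta (𝒰 : Cover M) (p : ℕ) : Cochain A 𝒰 p →+ Cochain A 𝒰 (p + 1) where
  toFun c σ := ∑ k : Fin (p + 2),
    (-1 : ℤ) ^ (k : ℕ) • LocallyConstant.comapAddMonoidHom (𝒰.face σ k) (c (σ ∘ k.succAbove))
  map_zero' := by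
    funext σ
    simp only [Pi.zero_apply, map_zero, smul_zero, Finset.sum_const_zero]
  map_add' c c' := by
    funext σ
    simp only [Pi.add_apply, map_add, smul_add, Finset.sum_add_distrib]

/-- Čech `p`-cocycles of a covering. -/
def cocycles (𝒰 : Cover M) (p : ℕ) : AddSubgroup (Cochain A 𝒰 p) := (delta A 𝒰 p).ker

/-- Čech cohomology in degree `p + 1` of a covering: cocycles modulo coboundaries. -/
abbrev CoverCech (𝒰 : Cover M) (p : ℕ) : Type _ :=
  cocycles A 𝒰 (p + 1) ⧸ (delta A 𝒰 p).range.addSubgroupOf (cocycles A 𝒰 (p + 1))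

variable {A} in
/-- Restriction of cochains to a refinement. -/
def Cochain.res {𝒰 𝒱 : Cover M} (h : 𝒰 ≤ 𝒱) (p : ℕ) : Cochain A 𝒰 p →+ Cochain A 𝒱 p where
  toFun c σ := LocallyConstant.comapAddMonoidHom
    (Cover.inclusion h σ) (c σ)
  map_zero' := by funext σ; simp only [Pi.zero_apply, map_zero]
  map_add' c c' := by funext σ; simp only [Pi.add_apply, map_add]

variable {A} in
/-- Change of coefficients along an additive map `A → B`. -/
def Cochain.mapCoeff {B : Type*} [AddCommGroup B] (f : A →+ B) (𝒰 : Cover M) (p : ℕ) :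
    Cochain A 𝒰 p →+ Cochain B 𝒰 p where
  toFun c σ := (c σ).map f
  map_zero' := by funext σ; ext y; simp
  map_add' c c' := by funext σ; ext y; simp

theorem delta_res {𝒰 𝒱 : Cover M} (h : 𝒰 ≤ 𝒱) (p : ℕ) (c : Cochain A 𝒰 p) :
    delta A 𝒱 p (Cochain.res h p c) = Cochain.res h (p + 1) (delta A 𝒰 p c) := by
  funext σ
  simp only [delta, Cochain.res, AddMonoidHom.coe_mk, ZeroHom.coe_mk, map_sum, map_zsmul]
  rfl

theorem delta_mapCoeff {B : Type*} [AddCommGroup B] (f : A →+ B) (𝒰 : Cover M) (p : ℕ)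
    (c : Cochain A 𝒰 p) :
    delta B 𝒰 p (Cochain.mapCoeff f 𝒰 p c) = Cochain.mapCoeff f 𝒰 (p + 1) (delta A 𝒰 p c) := by
  funext σ
  ext y
  change LocallyConstant.evalAddMonoidHom y _ = f (LocallyConstant.evalAddMonoidHom y _)
  simp only [delta, Cochain.mapCoeff, AddMonoidHom.coe_mk, ZeroHom.coe_mk, map_sum, map_zsmul]
  rfl

/-- A family of additive maps commuting with the Čech differentials induces a map on cocycles. -/
def cocycleMap {A B : Type*} [AddCommGroup A] [AddCommGroup B] {𝒰 𝒱 : Cover M}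
    (φ : ∀ p, Cochain A 𝒰 p →+ Cochain B 𝒱 p)
    (hφ : ∀ p c, delta B 𝒱 p (φ p c) = φ (p + 1) (delta A 𝒰 p c)) (p : ℕ) :
    cocycles A 𝒰 p →+ cocycles B 𝒱 p :=
  ((φ p).comp (cocycles A 𝒰 p).subtype).codRestrict _ fun c => by
    have hc : delta A 𝒰 p c = 0 := c.2
    change delta B 𝒱 p (φ p c) = 0
    rw [hφ, hc, map_zero]

/-- The map induced by a morphism of Čech complexes on the cohomology of coverings. -/
def coverCechMap {A B : Type*} [AddCommGroup A] [AddCommGroup B] {𝒰 𝒱 : Cover M}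
    (φ : ∀ p, Cochain A 𝒰 p →+ Cochain B 𝒱 p)
    (hφ : ∀ p c, delta B 𝒱 p (φ p c) = φ (p + 1) (delta A 𝒰 p c)) (p : ℕ) :
    CoverCech A 𝒰 p →+ CoverCech B 𝒱 p :=
  QuotientAddGroup.map _ _ (cocycleMap φ hφ (p + 1)) (by
    rintro ⟨c, hc⟩ ⟨b, hb⟩
    exact ⟨φ p b, (hφ p b).trans (congrArg (φ (p + 1)) hb)⟩)

/-- Refinement map on the cohomology of coverings. -/
def coverCechRes (p : ℕ) (𝒰 𝒱 : Cover M) (h : 𝒰 ≤ 𝒱) : CoverCech A 𝒰 p →+ CoverCech A 𝒱 p :=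
  coverCechMap (fun q => Cochain.res h q) (fun q c => delta_res A h q c) p

/-- Change of coefficients on the cohomology of a covering. -/
def coverCechCoeff {A B : Type*} [AddCommGroup A] [AddCommGroup B] (f : A →+ B) (p : ℕ)
    (𝒰 : Cover M) : CoverCech A 𝒰 p →+ CoverCech B 𝒰 p :=
  coverCechMap (fun q => Cochain.mapCoeff f 𝒰 q) (fun q c => delta_mapCoeff A f 𝒰 q c) p

variable (M)

open Classical in
/-- Čech cohomology `Ȟ^{p+1}(M, A)`: the direct limit over open coverings. -/
abbrev Cech (p : ℕ) : Type _ :=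
  AddCommGroup.DirectLimit (fun 𝒰 : Cover M => CoverCech A 𝒰 p) (coverCechRes A p)

variable {M A}

open Classical in
/-- The class in `Ȟ^{p+1}(M, A)` of a cocycle of a covering. -/
def cechClass {𝒰 : Cover M} {p : ℕ} (a : cocycles A 𝒰 (p + 1)) : Cech M A p :=
  AddCommGroup.DirectLimit.of (fun 𝒰 : Cover M => CoverCech A 𝒰 p) (coverCechRes A p) 𝒰
    (QuotientAddGroup.mk a)

variable (M)

open Classical in
/-- The morphism `Ȟ^{p+1}(M, A) → Ȟ^{p+1}(M, B)` induced by `f : A → B`. -/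
def cechCoeff {A B : Type*} [AddCommGroup A] [AddCommGroup B] (f : A →+ B) (p : ℕ) :
    Cech M A p →+ Cech M B p :=
  AddCommGroup.DirectLimit.map (fun 𝒰 => coverCechCoeff f p 𝒰) (fun 𝒰 𝒱 h => by
    refine AddMonoidHom.ext fun c => ?_
    induction c using QuotientAddGroup.induction_on
    rfl)

end Cech

/-! ### The de Rham–Čech correspondence and integral classes -/

section Integral

variable {E : Type*} [NormedAddCommGroup E] [NormedSpace ℝ E]
  {M : Type*} [TopologicalSpace M] [ChartedSpace E M]

/-- The real Čech 2-cocycle `a` of `𝒰` is obtained from the closed 2-form `Ω` by the usual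
zig-zag: there are 1-forms `α_l` on `U_l` with `dα_l = Ω`, and functions `f_{lj}` on `U_l ∩ U_j`
with `α_j - α_l = df_{lj}`, such that `a_{ljk} = f_{lj} + f_{jk} - f_{lk}` on `U_l ∩ U_j ∩ U_k`. -/
def IsZigZag (Ω : closedForms E M 2) (𝒰 : Cover M) (a : cocycles ℝ 𝒰 2) : Prop :=
  ∃ (α : M → Form E M ℝ 1) (f : M → M → M → ℝ),
    (∀ l, (α l).SmoothOn (𝒰.U l)) ∧
    (∀ l, ∀ y ∈ 𝒰.U l, (α l).d y = Ω.1.1 y) ∧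
    (∀ l j, ContMDiffOn 𝓘(ℝ, E) 𝓘(ℝ, ℝ) ∞ (f l j) (𝒰.U l ⊓ 𝒰.U j : Opens M)) ∧
    (∀ l j, ∀ y ∈ 𝒰.U l ⊓ 𝒰.U j, ∀ v : TangentSpace 𝓘(ℝ, E) y,
      α j y ![v] - α l y ![v] = mfderiv 𝓘(ℝ, E) 𝓘(ℝ, ℝ) (f l j) y v) ∧
    (∀ (σ : Fin 3 → M) (y : 𝒰.inter σ),
      a.1 σ y = f (σ 0) (σ 1) y + f (σ 1) (σ 2) y - f (σ 0) (σ 2) y)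

/-- The graph of the canonical isomorphism `H²(M, ℝ) ≃ Ȟ²(M, ℝ)` from de Rham to Čech
cohomology. -/
def DeRhamCech (c : DeRham E M 1) (k : Cech M ℝ 1) : Prop :=
  ∃ (Ω : closedForms E M 2) (𝒰 : Cover M) (a : cocycles ℝ 𝒰 2),
    Submodule.Quotient.mk Ω = c ∧ IsZigZag Ω 𝒰 a ∧ cechClass a = k

/-- A class in `H²(M, ℝ)` is integral if the corresponding Čech class lies in the image of
`ε² : Ȟ²(M, ℤ) → Ȟ²(M, ℝ)`, induced by the inclusion `ℤ → ℝ`. -/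
def IsIntegralClass (c : DeRham E M 1) : Prop :=
  ∃ n : Cech M ℤ 1, DeRhamCech c (cechCoeff M (Int.castAddHom ℝ) 1 n)

end Integral

/-! ### Hermitian line bundles with connection -/

section LineBundles

variable (E : Type*) [NormedAddCommGroup E] [NormedSpace ℝ E]
  (M : Type*) [TopologicalSpace M] [ChartedSpace E M] [IsManifold 𝓘(ℝ, E) ∞ M]

/-- A smooth complex line bundle on `M`: a fibre bundle with model fibre `ℂ`, whose fibres are
complex vector spaces, with complex linear trivializations and smooth transition functions. The
fibres, being in bijection with `ℂ`, are taken in `Type`. -/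
structure LineBundle where
  Fiber : M → Type
  [addCommGroup : ∀ x, AddCommGroup (Fiber x)]
  [module : ∀ x, Module ℂ (Fiber x)]
  [topologicalSpace : ∀ x, TopologicalSpace (Fiber x)]
  [totalSpaceTopology : TopologicalSpace (TotalSpace ℂ Fiber)]
  [fiberBundle : FiberBundle ℂ Fiber]
  [vectorBundle : VectorBundle ℂ ℂ Fiber]
  [realVectorBundle : VectorBundle ℝ ℂ Fiber]
  [smooth : ContMDiffVectorBundle ∞ ℂ Fiber 𝓘(ℝ, E)]

attribute [instance] LineBundle.addCommGroup LineBundle.module LineBundle.topologicalSpace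
  LineBundle.totalSpaceTopology LineBundle.fiberBundle LineBundle.vectorBundle
  LineBundle.realVectorBundle LineBundle.smooth

variable {E M}

/-- `Γ(L)`: the smooth sections of `L`. -/
abbrev LineBundle.Sections (L : LineBundle E M) : Type _ :=
  ContMDiffSection 𝓘(ℝ, E) ℂ ∞ L.Fiber

/-- The product `f s` of a smooth complex function and a smooth section. -/
def LineBundle.mulSection (L : LineBundle E M) (f : C^∞⟮𝓘(ℝ, E), M; 𝓘(ℝ, ℂ), ℂ⟯)
    (s : L.Sections) : L.Sections where
  toFun x := f x • s x
  contMDiff_toFun x₀ := by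
    rw [contMDiffAt_section]
    have hs := (contMDiffAt_section x₀).1 (s.contMDiff x₀)
    refine ((contDiff_mul (𝕜 := ℝ) (𝔸 := ℂ)).contMDiff.contMDiffAt.comp x₀
      ((f.contMDiff x₀).prodMk_space hs)).congr_of_eventuallyEq ?_
    filter_upwards [(trivializationAt ℂ L.Fiber x₀).open_baseSet.mem_nhds
      (FiberBundle.mem_baseSet_trivializationAt' x₀)] with x hx
    exact ((trivializationAt ℂ L.Fiber x₀).linear ℂ hx).map_smul (f x) (s x)

/-- A connection on `L`: a map `∇` from smooth sections to smooth `L`-valued 1-forms (where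
`∇ s x v` stands for `(∇_v s)(x)`) which is additive and satisfies
`∇(f s) = df ⊗ s + f ∇s` for smooth complex functions `f`. -/
structure Connection (L : LineBundle E M) where
  nabla : L.Sections → ∀ x : M, TangentSpace 𝓘(ℝ, E) x →ₗ[ℝ] L.Fiber x
  smooth : ∀ (s : L.Sections) (X : ContMDiffSection 𝓘(ℝ, E) E ∞ (TangentSpace 𝓘(ℝ, E) : M → Type _)),
    ContMDiff 𝓘(ℝ, E) (𝓘(ℝ, E).prod 𝓘(ℝ, ℂ)) ∞
      (fun x => TotalSpace.mk' ℂ x (nabla s x (X x)))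
  add : ∀ (s t : L.Sections) (x : M), nabla (s + t) x = nabla s x + nabla t x
  leibniz : ∀ (f : C^∞⟮𝓘(ℝ, E), M; 𝓘(ℝ, ℂ), ℂ⟯) (s : L.Sections) (x : M)
    (v : TangentSpace 𝓘(ℝ, E) x),
    nabla (L.mulSection f s) x v =
      (show ℂ from mfderiv 𝓘(ℝ, E) 𝓘(ℝ, ℂ) f x v) • s x + f x • nabla s x v

/-- `α` is the connection 1-form of `∇` on `U` relative to the section `s`, nowhere zero on `U`:
`∇ s = 2πi α ⊗ s` on `U`. -/
def Connection.IsConnectionForm {L : LineBundle E M} (D : Connection L) (U : Opens M)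
    (s : L.Sections) (α : Form E M ℂ 1) : Prop :=
  ∀ x ∈ U, s x ≠ 0 ∧ ∀ v : TangentSpace 𝓘(ℝ, E) x,
    D.nabla s x v = (2 * Real.pi * Complex.I * α x ![v] : ℂ) • s x

/-- `curv ∇ = Ω` for a real 2-form `Ω`: one has `Ω = dα` on `U` for every local connection 1-form
`α` of `∇`. (Near each point there is a nowhere zero section, extending to a global one.) -/
def Connection.HasCurvature {L : LineBundle E M} (D : Connection L) (Ω : Form E M ℝ 2) : Prop :=
  ∀ (U : Opens M) (s : L.Sections) (α : Form E M ℂ 1), D.IsConnectionForm U s α →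
    ∀ x ∈ U, ∀ v w : TangentSpace 𝓘(ℝ, E) x, α.d x ![v, w] = (Ω x ![v, w] : ℂ)

/-- A hermitian structure on `L`: a smoothly varying family of hermitian (positive definite) inner
products on the fibres, complex linear in the first variable. -/
structure HermitianMetric (L : LineBundle E M) where
  inner : ∀ x : M, L.Fiber x → L.Fiber x → ℂ
  add_left : ∀ (x : M) (u v w : L.Fiber x), inner x (u + v) w = inner x u w + inner x v w
  smul_left : ∀ (x : M) (c : ℂ) (v w : L.Fiber x), inner x (c • v) w = c * inner x v w
  conj_symm : ∀ (x : M) (v w : L.Fiber x), inner x v w = starRingEnd ℂ (inner x w v)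
  pos : ∀ (x : M) (v : L.Fiber x), v ≠ 0 → 0 < (inner x v v).re
  smooth : ∀ s t : L.Sections,
    ContMDiff 𝓘(ℝ, E) 𝓘(ℝ, ℂ) ∞ (fun x => inner x (s x) (t x))

/-- `∇` is hermitian with respect to `h`: `X (h(s, t)) = h(∇_X s, t) + h(s, ∇_X t)`. -/
def Connection.IsHermitian {L : LineBundle E M} (D : Connection L) (h : HermitianMetric L) : Prop :=
  ∀ (s t : L.Sections) (x : M) (v : TangentSpace 𝓘(ℝ, E) x),
    (show ℂ from mfderiv 𝓘(ℝ, E) 𝓘(ℝ, ℂ) (fun y => h.inner y (s y) (t y)) x v) =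
      h.inner x (D.nabla s x v) (t x) + h.inner x (s x) (D.nabla t x v)

/-- A prequantization of `(M, Ω)`: a complex line bundle with a hermitian metric and a compatible
connection whose curvature is `Ω / 2πħ`. -/
structure Prequantization (Ω : SymplecticForm E M) (hbar : ℝ) where
  bundle : LineBundle E M
  metric : HermitianMetric bundle
  connection : Connection bundle
  hermitian : connection.IsHermitian metric
  curvature : connection.HasCurvature (Ω.scaled hbar).1.1

/-- An isomorphism of complex line bundles over the identity of `M`: a fibrewise complex linear
diffeomorphism of the total spaces. -/
structure LineBundleIso (L L' : LineBundle E M) where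
  equiv : ∀ x : M, L.Fiber x ≃ₗ[ℂ] L'.Fiber x
  smooth : ContMDiff (𝓘(ℝ, E).prod 𝓘(ℝ, ℂ)) (𝓘(ℝ, E).prod 𝓘(ℝ, ℂ)) ∞
    (fun p : TotalSpace ℂ L.Fiber => TotalSpace.mk' ℂ p.1 (equiv p.1 p.2))
  smooth_symm : ContMDiff (𝓘(ℝ, E).prod 𝓘(ℝ, ℂ)) (𝓘(ℝ, E).prod 𝓘(ℝ, ℂ)) ∞
    (fun p : TotalSpace ℂ L'.Fiber => TotalSpace.mk' ℂ p.1 ((equiv p.1).symm p.2))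

/-- `Γ(φ) : Γ(L) → Γ(L')`, `s ↦ φ ∘ s`. -/
def LineBundleIso.mapSection {L L' : LineBundle E M} (φ : LineBundleIso L L') (s : L.Sections) :
    L'.Sections where
  toFun x := φ.equiv x (s x)
  contMDiff_toFun := φ.smooth.comp s.contMDiff

/-- Equivalence of line bundles with metric and connection: there is a line bundle isomorphism `φ`
with `h = φ^* h'` and `∇' ∘ Γ(φ) = (id ⊗ Γ(φ)) ∘ ∇`. -/
def Prequantization.Equivalent {Ω : SymplecticForm E M} {hbar : ℝ}
    (P P' : Prequantization Ω hbar) : Prop :=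
  ∃ φ : LineBundleIso P.bundle P'.bundle,
    (∀ (x : M) (v w : P.bundle.Fiber x),
      P.metric.inner x v w = P'.metric.inner x (φ.equiv x v) (φ.equiv x w)) ∧
    (∀ (s : P.bundle.Sections) (x : M) (v : TangentSpace 𝓘(ℝ, E) x),
      P'.connection.nabla (φ.mapSection s) x v = φ.equiv x (P.connection.nabla s x v))

end LineBundles

end Prequantum

end

/-! Over a set where the bundle has a section e_l of length one, the connection is a 1-form α_l with
dα_l = Ω/2πħ. It is real, because differentiating h(e_l, e_l) = 1 makes h(∇e_l, e_l) imaginary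
(`HermitianMetric.IsUnitOn.nabla_eq`, `Connection.d_unitForm`). Two such sections are related by e_j
= g_lj e_l with |g_lj| = 1, and compatibility with h gives dg_lj = 2πi (α_j − α_l) g_lj. Writing
g_lj = exp(2πi f_lj) yields df_lj = α_j − α_l, so α and f form a zig-zag for Ω/2πħ, and g_lj g_jk =
g_lk says exactly that f_lj + f_jk − f_lk is an integer. This is necessity. The logarithms do not
need a good covering: by `exists_cover_subordinate` the members can be taken so small that each g_lj
varies little on the whole of U_l, hence has a branch of the logarithm there.

For sufficiency, integrality concerns a class only, so the zig-zag is first corrected: by an exact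
form, to reach the given representative, and by a real cochain on a refinement, to make f_lj + f_jk
− f_lk itself integral (`exists_integral_cochain`, `IsIntegralClass.exists_potentialData`). Then the
functions exp(2πi f_lj) are transition functions of a line bundle, the standard metric of ℂ is
invariant under them, and the operators d + 2πi α_l glue to a connection because df_lj = α_j − α_l
(`PotentialData.IsSmoothSection.localCov_change`).

For uniqueness, the connection forms of two prequantizations differ locally by a closed, hence
locally exact, form. Rotating one unit section by a phase gives local unit sections e_x, e'_x with
the same connection form. The maps e_x ↦ e'_x are local equivalences, and they disagree on overlaps
by locally constant numbers of modulus one. Such a cocycle defines a covering space with discrete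
fibre; over a simply connected base it has a section, so the cocycle is a coboundary
(`exists_locallyConstant_coboundary`) and the local equivalences can be rotated by constants until
they agree. -/

noncomputable section

set_option linter.unusedSectionVars false

namespace Prequantum

/-! ### Calculus of forms in charts -/

section FormCalculus

open ContinuousAlternatingMap
open scoped Topology

variable {E : Type*} [NormedAddCommGroup E] [NormedSpace ℝ E]
  {M : Type*} [TopologicalSpace M] [ChartedSpace E M]
  {F : Type*} [NormedAddCommGroup F] [NormedSpace ℝ F]

theorem two_le_infty : (2 : WithTop ℕ∞) ≤ ∞ :=
  WithTop.coe_le_coe.2 (le_top : (2 : ℕ∞) ≤ ⊤)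

/-- The domain, in the preferred chart at `x₀`, of a form defined on `U`. -/
theorem isOpen_chart_domain (x₀ : M) (U : Opens M) :
    IsOpen ((chartAt E x₀).target ∩ (chartAt E x₀).symm ⁻¹' (U : Set M)) :=
  (chartAt E x₀).isOpen_inter_preimage_symm U.2

theorem Form.inChart_one_apply (α : Form E M F 1) (x₀ : M) (y w : E) :
    α.inChart x₀ y ![w] = α ((chartAt E x₀).symm y)
      ![(mfderiv 𝓘(ℝ, E) 𝓘(ℝ, E) (chartAt E x₀).symm y : E →L[ℝ] E) w] := by
  change α _ _ = α _ _
  congr 1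
  funext i
  fin_cases i
  rfl

theorem Form.ext_one {α β : Form E M F 1} {x : M}
    (h : ∀ v : TangentSpace 𝓘(ℝ, E) x, α x ![v] = β x ![v]) : α x = β x := by
  ext v
  have : v = ![v 0] := by funext i; fin_cases i; rfl
  rw [this]; exact h _

/-- A 1-form at `x` as a continuous linear map. -/
def Form.toLinear (α : Form E M F 1) (x : M) : TangentSpace 𝓘(ℝ, E) x →L[ℝ] F :=
  (ofSubsingleton ℝ (TangentSpace 𝓘(ℝ, E) x) F (0 : Fin 1)).symm (α x)

theorem Form.toLinear_apply (α : Form E M F 1) (x : M) (v : TangentSpace 𝓘(ℝ, E) x) :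
    α.toLinear x v = α x ![v] := by
  change α x (fun _ => v) = _
  congr 1
  funext i
  fin_cases i
  rfl

/-- The 1-form `x ↦ A x`. -/
def Form.ofLinear (A : ∀ x : M, TangentSpace 𝓘(ℝ, E) x →L[ℝ] F) : Form E M F 1 := fun x =>
  ofSubsingleton ℝ (TangentSpace 𝓘(ℝ, E) x) F 0 (A x)

variable (F) in
/-- The differential of a function, as a 1-form. -/
def Form.diff (f : M → F) : Form E M F 1 :=
  Form.ofLinear fun x => (mfderiv 𝓘(ℝ, E) 𝓘(ℝ, F) f x : TangentSpace 𝓘(ℝ, E) x →L[ℝ] F)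

theorem Form.diff_apply (f : M → F) (x : M) (v : TangentSpace 𝓘(ℝ, E) x) :
    Form.diff (E := E) F f x ![v] = mfderiv 𝓘(ℝ, E) 𝓘(ℝ, F) f x v := rfl

/-- Composition of a form with a linear map of the values. -/
def Form.map {G : Type*} [NormedAddCommGroup G] [NormedSpace ℝ G] (T : F →L[ℝ] G) {p : ℕ}
    (α : Form E M F p) : Form E M G p := fun x => T.compContinuousAlternatingMap (α x)

theorem Form.SmoothOn.mono {p : ℕ} {α : Form E M F p} {U V : Opens M} (h : α.SmoothOn U)
    (hVU : V ≤ U) : α.SmoothOn V := fun x₀ =>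
  (h x₀).mono (Set.inter_subset_inter_right _ (Set.preimage_mono hVU))

theorem Form.SmoothOn.differentiableAt_of_mem {p : ℕ} {α : Form E M F p} {U : Opens M}
    (h : α.SmoothOn U) {x₀ : M} {y : E} (hy : y ∈ (chartAt E x₀).target)
    (hU : (chartAt E x₀).symm y ∈ U) : DifferentiableAt ℝ (α.inChart x₀) y :=
  ((h x₀).contDiffAt ((isOpen_chart_domain x₀ U).mem_nhds ⟨hy, hU⟩)).differentiableAt (by simp)

theorem Form.SmoothOn.differentiableAt_self {p : ℕ} {α : Form E M F p} {U : Opens M}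
    (h : α.SmoothOn U) {x : M} (hx : x ∈ U) :
    DifferentiableAt ℝ (α.inChart x) (chartAt E x x) :=
  h.differentiableAt_of_mem (mem_chart_target E x) (by simpa using hx)

theorem tendsto_chart_symm {x₀ : M} {y : E} (hy : y ∈ (chartAt E x₀).target) :
    Filter.Tendsto (chartAt E x₀).symm (𝓝 y) (𝓝 ((chartAt E x₀).symm y)) :=
  (chartAt E x₀).continuousAt_symm hy

theorem Form.inChart_congr {p : ℕ} {α β : Form E M F p} {x₀ : M} {y : E}
    (hy : y ∈ (chartAt E x₀).target) (h : ∀ᶠ z in 𝓝 ((chartAt E x₀).symm y), α z = β z) :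
    α.inChart x₀ =ᶠ[𝓝 y] β.inChart x₀ := by
  filter_upwards [(tendsto_chart_symm hy).eventually h] with z hz
  simp only [Form.inChart, hz]

theorem Form.d_congr {p : ℕ} {α β : Form E M F p} {x : M} (h : ∀ᶠ z in 𝓝 x, α z = β z) :
    α.d x = β.d x := by
  have := (Form.inChart_congr (α := α) (β := β) (mem_chart_target E x)
    (by simpa using h)).extDeriv_eq
  simp only [Form.d, this]

theorem Form.d_add_apply {p : ℕ} {α β : Form E M F p} {U V : Opens M} (hα : α.SmoothOn U)
    (hβ : β.SmoothOn V) {x : M} (hU : x ∈ U) (hV : x ∈ V) : (α + β).d x = α.d x + β.d x := by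
  simp only [Form.d, Form.inChart_add,
    extDeriv_add (hα.differentiableAt_self hU) (hβ.differentiableAt_self hV)]
  rfl

theorem Form.SmoothOn.add {p : ℕ} {α β : Form E M F p} {U : Opens M} (hα : α.SmoothOn U)
    (hβ : β.SmoothOn U) : (α + β).SmoothOn U := fun x₀ => by
  rw [Form.inChart_add]; exact (hα x₀).add (hβ x₀)

theorem Form.SmoothOn.const_smul {p : ℕ} {α : Form E M F p} {U : Opens M} (c : ℝ)
    (hα : α.SmoothOn U) : (c • α).SmoothOn U := fun x₀ => by
  rw [Form.inChart_smul]; exact (hα x₀).const_smul c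

theorem Form.SmoothOn.map {G : Type*} [NormedAddCommGroup G] [NormedSpace ℝ G] (T : F →L[ℝ] G)
    {p : ℕ} {α : Form E M F p} {U : Opens M} (hα : α.SmoothOn U) : (α.map T).SmoothOn U :=
  fun x₀ => (T.compContinuousAlternatingMapCLM ℝ E F G (ι := Fin p)).contDiff.comp_contDiffOn (hα x₀)

/-- Allows real potentials to be compared with complex connection forms: a fixed linear map commutes
with the partial derivatives that make up d. -/
theorem Form.d_map {G : Type*} [NormedAddCommGroup G] [NormedSpace ℝ G] (T : F →L[ℝ] G)
    {p : ℕ} {α : Form E M F p} {U : Opens M} (hα : α.SmoothOn U) {x : M} (hx : x ∈ U) :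
    (α.map T).d x = T.compContinuousAlternatingMap (α.d x) := by
  have h1 := hα.differentiableAt_self hx
  have h2 := (hα.map T).differentiableAt_self hx
  have : extDeriv ((α.map T).inChart x) (chartAt E x x) =
      T.compContinuousAlternatingMap (extDeriv (α.inChart x) (chartAt E x x)) := by
    ext v
    rw [extDeriv_apply h2, T.compContinuousAlternatingMap_coe, Function.comp_apply,
      extDeriv_apply h1, _root_.map_sum]
    refine Finset.sum_congr rfl fun i _ => ?_
    have h3 : DifferentiableAt ℝ (fun y => α.inChart x y (i.removeNth v)) (chartAt E x x) :=
      h1.continuousAlternatingMap_apply_const _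
    have : (fun y => (α.map T).inChart x y (i.removeNth v)) =
        T ∘ (fun y => α.inChart x y (i.removeNth v)) := rfl
    rw [this, fderiv_comp _ T.differentiableAt h3, T.fderiv]
    exact (map_zsmul T _ _).symm
  simp only [Form.d, this]
  rfl

variable [FiniteDimensional ℝ E] [IsManifold 𝓘(ℝ, E) ∞ M]

theorem mdifferentiable_chartAt (x₀ : M) :
    (chartAt E x₀).MDifferentiable 𝓘(ℝ, E) 𝓘(ℝ, E) :=
  have : IsManifold 𝓘(ℝ, E) 1 M := .of_le (n := ∞) (by simp)
  mdifferentiable_chart x₀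

/-- The vector field `(φ⁻¹)_* w` of the preferred chart `φ` at `x₀`. -/
def chartFrame (x₀ : M) (w : E) (p : M) : TangentSpace 𝓘(ℝ, E) p :=
  (mfderiv 𝓘(ℝ, E) 𝓘(ℝ, E) (chartAt E x₀).symm (chartAt E x₀ p) : E →L[ℝ] E) w

theorem Form.inChart_eq_chartFrame (α : Form E M F 1) {x₀ : M} {y : E}
    (hy : y ∈ (chartAt E x₀).target) (w : E) :
    α.inChart x₀ y ![w] =
      α ((chartAt E x₀).symm y) ![chartFrame x₀ w ((chartAt E x₀).symm y)] := by
  rw [Form.inChart_one_apply, chartFrame, (chartAt E x₀).right_inv hy]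

/-- A 1-form is smooth if its coefficients in the frames of the preferred charts are. -/
theorem Form.smoothOn_of_chartFrame {α : Form E M F 1} {U : Opens M}
    (h : ∀ (x₀ : M) (w : E), ContMDiffOn 𝓘(ℝ, E) 𝓘(ℝ, F) ∞
      (fun p => α p ![chartFrame x₀ w p]) ((chartAt E x₀).source ∩ U)) : α.SmoothOn U := by
  intro x₀
  set S := (chartAt E x₀).target ∩ (chartAt E x₀).symm ⁻¹' (U : Set M)
  have h1 : ContDiffOn ℝ ∞ (fun y => (ofSubsingleton ℝ E F (0 : Fin 1)).symm (α.inChart x₀ y)) S := by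
    rw [contDiffOn_clm_apply]
    intro w
    have h2 : ContMDiffOn 𝓘(ℝ, E) 𝓘(ℝ, F) ∞
        ((fun p => α p ![chartFrame x₀ w p]) ∘ (chartAt E x₀).symm) S :=
      (h x₀ w).comp ((contMDiffOn_chart_symm (x := x₀)).mono Set.inter_subset_left)
        (fun y hy => ⟨(chartAt E x₀).map_target hy.1, hy.2⟩)
    refine (contMDiffOn_iff_contDiffOn.1 h2).congr fun y hy => ?_
    rw [Function.comp_apply, ← Form.inChart_eq_chartFrame α hy.1]
    change α.inChart x₀ y (fun _ => w) = _
    congr 1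
    funext i
    fin_cases i
    rfl
  exact ((ofSubsingletonLIE (𝕜 := ℝ) (0 : Fin 1)).contDiff.comp_contDiffOn h1).congr
    fun y _ => ((ofSubsingleton ℝ E F (0 : Fin 1)).apply_symm_apply _).symm

theorem Form.apply_eq_inChart (α : Form E M F 1) {x₀ p : M} (hp : p ∈ (chartAt E x₀).source)
    (v : TangentSpace 𝓘(ℝ, E) p) :
    α p ![v] = α.inChart x₀ (chartAt E x₀ p)
      ![(mfderiv 𝓘(ℝ, E) 𝓘(ℝ, E) (chartAt E x₀) p : TangentSpace 𝓘(ℝ, E) p →L[ℝ] E) v] := by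
  have h1 := DFunLike.congr_fun ((mdifferentiable_chartAt x₀).symm_comp_deriv hp) v
  refine Eq.trans ?_ (Form.inChart_one_apply α x₀ _ _).symm
  -- The point obtained by going to the chart and back equals p only propositionally, so the base
  -- point is generalised before the two tangent vectors are compared.
  have h2 : ∀ q, q = p → ∀ u : E, u = v → α p ![v] = α q ![u] := by
    rintro q rfl u rfl; rfl
  exact h2 _ ((chartAt E x₀).left_inv hp) _ h1

theorem trivializationAt_tangent_snd {x₀ p : M} (hp : p ∈ (chartAt E x₀).source)
    (v : TangentSpace 𝓘(ℝ, E) p) :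
    (trivializationAt E (TangentSpace 𝓘(ℝ, E) : M → Type _) x₀ ⟨p, v⟩).2 =
      (mfderiv 𝓘(ℝ, E) 𝓘(ℝ, E) (chartAt E x₀) p : TangentSpace 𝓘(ℝ, E) p →L[ℝ] E) v := by
  have : IsManifold 𝓘(ℝ, E) 1 M := .of_le (n := ∞) (by simp)
  have hp' : p ∈ (trivializationAt E (TangentSpace 𝓘(ℝ, E) : M → Type _) x₀).baseSet := by
    simpa using hp
  have h1 := DFunLike.congr_fun
    (TangentBundle.continuousLinearMapAt_trivializationAt (I := 𝓘(ℝ, E)) hp) v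
  have h2 := congrFun ((trivializationAt E
    (TangentSpace 𝓘(ℝ, E) : M → Type _) x₀).coe_linearMapAt_of_mem (R := ℝ) hp') v
  exact h2.symm.trans h1

theorem mfderiv_chartAt_chartFrame {x₀ p : M} (hp : p ∈ (chartAt E x₀).source) (w : E) :
    (mfderiv 𝓘(ℝ, E) 𝓘(ℝ, E) (chartAt E x₀) p : TangentSpace 𝓘(ℝ, E) p →L[ℝ] E)
      (chartFrame x₀ w p) = w := by
  have h1 := DFunLike.congr_fun
    ((mdifferentiable_chartAt x₀).comp_symm_deriv ((chartAt E x₀).map_source hp)) w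
  have h2 : ∀ q, q = p → ((mfderiv 𝓘(ℝ, E) 𝓘(ℝ, E) (chartAt E x₀) q : E →L[ℝ] E)
      (chartFrame x₀ w p) : E) =
        (mfderiv 𝓘(ℝ, E) 𝓘(ℝ, E) (chartAt E x₀) p : E →L[ℝ] E) (chartFrame x₀ w p) := by
    rintro q rfl; rfl
  exact (h2 _ ((chartAt E x₀).left_inv hp)).symm.trans h1

theorem contMDiffOn_chartFrame (x₀ : M) (w : E) :
    ContMDiffOn 𝓘(ℝ, E) (𝓘(ℝ, E).prod 𝓘(ℝ, E)) ∞
      (fun p => TotalSpace.mk' E p (chartFrame x₀ w p)) (chartAt E x₀).source := by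
  have h := ((trivializationAt E
    (TangentSpace 𝓘(ℝ, E) : M → Type _) x₀).contMDiffOn_section_baseSet_iff
      (IB := 𝓘(ℝ, E)) (n := ∞) (s := chartFrame x₀ w)).2
    ((contMDiffOn_const (c := w)).congr fun p hp => by
      rw [trivializationAt_tangent_snd (by simpa using hp)]
      exact mfderiv_chartAt_chartFrame (by simpa using hp) w)
  simpa using h

/-- Evaluating a smooth 1-form on a smooth vector field gives a smooth function. -/
theorem Form.SmoothOn.contMDiffOn_apply {α : Form E M F 1} {U : Opens M} (h : α.SmoothOn U)
    {X : ∀ p : M, TangentSpace 𝓘(ℝ, E) p}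
    (hX : ContMDiffOn 𝓘(ℝ, E) (𝓘(ℝ, E).prod 𝓘(ℝ, E)) ∞ (fun p => TotalSpace.mk' E p (X p)) U) :
    ContMDiffOn 𝓘(ℝ, E) 𝓘(ℝ, F) ∞ (fun p => α p ![X p]) U := by
  intro x₀ hx₀
  refine ContMDiffAt.contMDiffWithinAt ?_
  have hU : (U : Set M) ∈ 𝓝 x₀ := U.2.mem_nhds hx₀
  have hs : (chartAt E x₀).source ∈ 𝓝 x₀ :=
    (chartAt E x₀).open_source.mem_nhds (mem_chart_source E x₀)
  have h1 := (contMDiffAt_section x₀).1 ((hX x₀ hx₀).contMDiffAt hU)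
  have h2 : ContMDiffAt 𝓘(ℝ, E) 𝓘(ℝ, E [⋀^Fin 1]→L[ℝ] F) ∞
      (fun p => α.inChart x₀ (chartAt E x₀ p)) x₀ := by
    have h3 : ContDiffAt ℝ ∞ (α.inChart x₀) (chartAt E x₀ x₀) :=
      (h x₀).contDiffAt ((isOpen_chart_domain x₀ U).mem_nhds
        ⟨mem_chart_target E x₀, by simpa using hx₀⟩)
    exact h3.contMDiffAt.comp x₀ ((contMDiffOn_chart (x := x₀)).contMDiffAt hs)
  have h4 : ContMDiffAt 𝓘(ℝ, E) 𝓘(ℝ, E →L[ℝ] F) ∞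
      (fun p => (ofSubsingletonLIE (𝕜 := ℝ) (0 : Fin 1)).symm (α.inChart x₀ (chartAt E x₀ p))) x₀ :=
    (ofSubsingletonLIE (𝕜 := ℝ) (E := E) (F := F)
      (0 : Fin 1)).symm.contDiff.contDiffAt.contMDiffAt.comp x₀ h2
  refine (h4.clm_apply h1).congr_of_eventuallyEq ?_
  filter_upwards [hs] with p hp
  rw [Form.apply_eq_inChart α hp, trivializationAt_tangent_snd hp]
  change _ = α.inChart x₀ (chartAt E x₀ p) (fun _ => _)
  congr 1
  funext i
  fin_cases i
  rfl

theorem Form.inChart_diff (f : M → F) {x₀ : M} {y : E} (hy : y ∈ (chartAt E x₀).target)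
    (hf : MDifferentiableAt 𝓘(ℝ, E) 𝓘(ℝ, F) f ((chartAt E x₀).symm y)) :
    (Form.diff F f).inChart x₀ y =
      ofSubsingleton ℝ E F (0 : Fin 1) (fderiv ℝ (f ∘ (chartAt E x₀).symm) y) := by
  ext v
  have hv : v = ![v 0] := by funext i; fin_cases i; rfl
  rw [hv, Form.inChart_one_apply, Form.diff_apply]
  have h := mfderiv_comp y hf ((mdifferentiable_chartAt x₀).mdifferentiableAt_symm hy)
  rw [mfderiv_eq_fderiv] at h
  change _ = fderiv ℝ (f ∘ (chartAt E x₀).symm) y (v 0)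
  rw [h]
  rfl

theorem contDiffOn_comp_chart_symm {f : M → F} {U : Opens M}
    (hf : ContMDiffOn 𝓘(ℝ, E) 𝓘(ℝ, F) ∞ f U) (x₀ : M) :
    ContDiffOn ℝ ∞ (f ∘ (chartAt E x₀).symm)
      ((chartAt E x₀).target ∩ (chartAt E x₀).symm ⁻¹' (U : Set M)) :=
  contMDiffOn_iff_contDiffOn.1 (hf.comp ((contMDiffOn_chart_symm (x := x₀)).mono
    Set.inter_subset_left) fun _ hy => hy.2)

theorem _root_.ContMDiffOn.mdifferentiableAt_of_mem_opens {f : M → F} {U : Opens M}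
    (hf : ContMDiffOn 𝓘(ℝ, E) 𝓘(ℝ, F) ∞ f U) {x : M} (hx : x ∈ U) :
    MDifferentiableAt 𝓘(ℝ, E) 𝓘(ℝ, F) f x :=
  ((hf x hx).contMDiffAt (U.2.mem_nhds hx)).mdifferentiableAt (by simp)

theorem Form.smoothOn_diff {f : M → F} {U : Opens M}
    (hf : ContMDiffOn 𝓘(ℝ, E) 𝓘(ℝ, F) ∞ f U) : (Form.diff (E := E) F f).SmoothOn U := by
  intro x₀
  have h1 := (contDiffOn_comp_chart_symm hf x₀).fderiv_of_isOpen (m := ∞)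
    (isOpen_chart_domain x₀ U) (by simp)
  refine ((ofSubsingletonLIE (𝕜 := ℝ) (0 : Fin 1)).contDiff.comp_contDiffOn h1).congr fun y hy => ?_
  exact Form.inChart_diff f hy.1 (hf.mdifferentiableAt_of_mem_opens hy.2)

/-- In a chart df is the exterior derivative of f regarded as a 0-form, so d ∘ d = 0 on E applies.
The identification is made on a neighbourhood because it is differentiated once more. -/
theorem Form.d_diff {f : M → F} {U : Opens M}
    (hf : ContMDiffOn 𝓘(ℝ, E) 𝓘(ℝ, F) ∞ f U) {x : M} (hx : x ∈ U) :
    (Form.diff (E := E) F f).d x = 0 := by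
  have hy : chartAt E x x ∈ (chartAt E x).target ∩ (chartAt E x).symm ⁻¹' (U : Set M) :=
    ⟨mem_chart_target E x, by simpa using hx⟩
  have h1 : (Form.diff F f).inChart x =ᶠ[𝓝 (chartAt E x x)]
      extDeriv (fun y => constOfIsEmpty ℝ E (Fin 0) ((f ∘ (chartAt E x).symm) y)) := by
    filter_upwards [(isOpen_chart_domain x U).mem_nhds hy] with y hy
    rw [extDeriv_constOfIsEmpty]
    exact Form.inChart_diff f hy.1 (hf.mdifferentiableAt_of_mem_opens hy.2)
  have h2 : ContDiffAt ℝ ∞ (fun y => constOfIsEmpty ℝ E (Fin 0) ((f ∘ (chartAt E x).symm) y))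
      (chartAt E x x) :=
    (constOfIsEmptyLIE ℝ E F (Fin 0)).contDiff.contDiffAt.comp _
      ((contDiffOn_comp_chart_symm hf x).contDiffAt ((isOpen_chart_domain x U).mem_nhds hy))
  have h3 := h1.extDeriv_eq.trans (extDeriv_extDeriv_apply h2
    (by rw [minSmoothness_of_isRCLikeNormedField]; exact two_le_infty))
  simp only [Form.d, h3]
  rfl

end FormCalculus

/-! ### The Poincaré lemma for 1-forms -/

section FormCalculus

open ContinuousAlternatingMap
open scoped Topology

variable {E : Type*} [NormedAddCommGroup E] [NormedSpace ℝ E]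
  {M : Type*} [TopologicalSpace M] [ChartedSpace E M]
  {F : Type*} [NormedAddCommGroup F] [NormedSpace ℝ F]

variable [FiniteDimensional ℝ E] [IsManifold 𝓘(ℝ, E) ∞ M]

/-- `Form.d` at a point looks only at the centre of the preferred chart of that point. To integrate
on a ball in one chart, closedness is needed at all points of that chart; it is transported by the
transition map, with which the exterior derivative commutes. -/
theorem Form.extDeriv_inChart_eq_zero {α : Form E M F 1} {U : Opens M} (hα : α.SmoothOn U)
    (hd : ∀ y ∈ U, α.d y = 0) {x₀ : M} {z : E} (hz : z ∈ (chartAt E x₀).target)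
    (hzU : (chartAt E x₀).symm z ∈ U) : extDeriv (α.inChart x₀) z = 0 := by
  set y := (chartAt E x₀).symm z with hy
  set τ : E → E := chartAt E y ∘ (chartAt E x₀).symm with hτ
  have hτz : τ z = chartAt E y y := rfl
  have hmem : ∀ᶠ z' in 𝓝 z, z' ∈ (chartAt E x₀).target ∧
      (chartAt E x₀).symm z' ∈ (chartAt E y).source :=
    Filter.Eventually.and ((chartAt E x₀).open_target.mem_nhds hz)
      ((tendsto_chart_symm hz).eventually
        ((chartAt E y).open_source.mem_nhds (mem_chart_source E y)))
  have h1 : α.inChart x₀ =ᶠ[𝓝 z]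
      fun z' => (α.inChart y (τ z')).compContinuousLinearMap (fderiv ℝ τ z') := by
    filter_upwards [hmem] with z' hz'
    ext v
    have hv : v = ![v 0] := by funext i; fin_cases i; rfl
    have h2 := mfderiv_comp z' ((mdifferentiable_chartAt y).mdifferentiableAt hz'.2)
      ((mdifferentiable_chartAt x₀).mdifferentiableAt_symm hz'.1)
    rw [mfderiv_eq_fderiv] at h2
    rw [hv, Form.inChart_one_apply]
    refine (Form.apply_eq_inChart α hz'.2 _).trans ?_
    change α.inChart y (τ z') ![_] = α.inChart y (τ z') _
    congr 1
    funext i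
    fin_cases i
    exact (DFunLike.congr_fun h2 (v 0)).symm
  have hτ' : ContDiffAt ℝ ∞ τ z := by
    have h3 : ContMDiffAt 𝓘(ℝ, E) 𝓘(ℝ, E) ∞ τ z :=
      ((contMDiffOn_chart (x := y)).contMDiffAt
        ((chartAt E y).open_source.mem_nhds (mem_chart_source E y))).comp z
        ((contMDiffOn_chart_symm (x := x₀)).contMDiffAt ((chartAt E x₀).open_target.mem_nhds hz))
    exact h3.contDiffAt
  have h4 : extDeriv (α.inChart y) (chartAt E y y) = 0 := by
    ext v
    have hsurj := (mdifferentiable_chartAt y).mfderiv_surjective (mem_chart_source E y)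
    choose u hu using fun i => hsurj (v i)
    have h5 := congrArg (fun A => A u) (hd y hzU)
    change extDeriv (α.inChart y) (chartAt E y y)
      (fun i => mfderiv 𝓘(ℝ, E) 𝓘(ℝ, E) (chartAt E y) y (u i)) = 0 at h5
    simp only [hu] at h5
    exact h5
  rw [h1.extDeriv_eq, extDeriv_pullback (by rw [hτz]; exact hα.differentiableAt_self hzU) hτ'
    (by rw [minSmoothness_of_isRCLikeNormedField]; exact two_le_infty), hτz, h4]
  rfl

/-- Closed 1-forms are locally exact. -/
theorem Form.exists_diff_eq {α : Form E M F 1} [CompleteSpace F] {U : Opens M} (hα : α.SmoothOn U)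
    (hd : ∀ y ∈ U, α.d y = 0) {x : M} (hx : x ∈ U) :
    ∃ (W : Opens M) (f : M → F), x ∈ W ∧ W ≤ U ∧ ContMDiffOn 𝓘(ℝ, E) 𝓘(ℝ, F) ∞ f W ∧
      ∀ p ∈ W, ∀ v : TangentSpace 𝓘(ℝ, E) p, mfderiv 𝓘(ℝ, E) 𝓘(ℝ, F) f p v = α p ![v] := by
  set φ := chartAt E x with hφ
  obtain ⟨r, hr, hball⟩ := Metric.isOpen_iff.1 (isOpen_chart_domain x U) (φ x)
    ⟨mem_chart_target E x, by simpa [hφ] using hx⟩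
  set B := Metric.ball (φ x) r with hB
  set η : E → E →L[ℝ] F := fun z => (ofSubsingleton ℝ E F (0 : Fin 1)).symm (α.inChart x z) with hη
  have hηsmooth : ContDiffOn ℝ ∞ η B :=
    (ofSubsingletonLIE (𝕜 := ℝ) (E := E) (F := F) (0 : Fin 1)).symm.contDiff.comp_contDiffOn
      ((hα x).mono hball)
  have hηapp : ∀ z w, η z w = α.inChart x z ![w] := by
    intro z w
    change α.inChart x z (fun _ => w) = _
    congr 1
    funext i
    fin_cases i
    rfl
  have hηdiff : ∀ z ∈ B, DifferentiableAt ℝ η z := fun z hz =>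
    (hηsmooth.contDiffAt (Metric.isOpen_ball.mem_nhds hz)).differentiableAt (by simp)
  -- For a 1-form, closedness is symmetry of the derivative of its coefficient map, which is the
  -- integrability condition on a convex open set.
  have hsymm : ∀ z ∈ B, ∀ a b, fderiv ℝ η z a b = fderiv ℝ η z b a := by
    intro z hz a b
    have h1 := Form.extDeriv_inChart_eq_zero hα hd (hball hz).1 (hball hz).2
    have h2 := congrArg (fun A => A ![a, b]) h1
    have h3 := extDeriv_apply (hα.differentiableAt_of_mem (hball hz).1 (hball hz).2) ![a, b]
    have h4 : ∀ u w, fderiv ℝ η z u w = fderiv ℝ (fun z => α.inChart x z ![w]) z u := by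
      intro u w
      have : (fun z => α.inChart x z ![w]) = fun z => η z w := funext fun z => (hηapp z w).symm
      rw [this, fderiv_clm_apply (hηdiff z hz) (differentiableAt_const w)]
      simp
    have e0 : (Fin.removeNth 0 ![a, b] : Fin 1 → E) = ![b] := by
      funext i; fin_cases i; rfl
    have e1 : (Fin.removeNth 1 ![a, b] : Fin 1 → E) = ![a] := by
      funext i; fin_cases i; rfl
    rw [Fin.sum_univ_two, e0, e1] at h3
    simp only [Fin.val_zero, pow_zero, one_smul, Fin.val_one, pow_one, neg_smul,
      Matrix.cons_val_zero, Matrix.cons_val_one] at h3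
    rw [h4, h4, ← sub_eq_zero, sub_eq_add_neg]
    exact h3.symm.trans h2
  obtain ⟨f, hf⟩ := (convex_ball (φ x) r).exists_forall_hasFDerivAt_of_fderiv_symmetric
    Metric.isOpen_ball (fun z hz => (hηdiff z hz).differentiableWithinAt) hsymm
  have hfs : ContDiffOn ℝ ∞ f B := by
    rw [contDiffOn_infty_iff_fderiv_of_isOpen Metric.isOpen_ball]
    exact ⟨fun z hz => (hf z hz).differentiableAt.differentiableWithinAt,
      hηsmooth.congr fun z hz => (hf z hz).fderiv⟩
  refine ⟨⟨φ.source ∩ φ ⁻¹' B, φ.isOpen_inter_preimage Metric.isOpen_ball⟩, f ∘ φ,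
    ⟨mem_chart_source E x, Metric.mem_ball_self hr⟩, ?_, ?_, ?_⟩
  · rintro p ⟨hp, hpB⟩
    have := (hball hpB).2
    rwa [Set.mem_preimage, φ.left_inv hp] at this
  · exact hfs.contMDiffOn.comp ((contMDiffOn_chart (x := x)).mono Set.inter_subset_left)
      fun p hp => hp.2
  · rintro p ⟨hp, hpB⟩ v
    have h1 := mfderiv_comp p (hf _ hpB).differentiableAt.mdifferentiableAt
      ((mdifferentiable_chartAt x).mdifferentiableAt hp)
    rw [mfderiv_eq_fderiv, (hf _ hpB).fderiv] at h1
    exact (DFunLike.congr_fun h1 v).trans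
      ((hηapp _ _).trans (Form.apply_eq_inChart α hp v).symm)

end FormCalculus

/-! ### Sections, germs and hermitian metrics -/

section BundleCalculus

open scoped Topology ComplexConjugate

variable {E : Type*} [NormedAddCommGroup E] [NormedSpace ℝ E] [FiniteDimensional ℝ E]
  {M : Type*} [TopologicalSpace M] [ChartedSpace E M] [IsManifold 𝓘(ℝ, E) ∞ M] [T2Space M]

theorem exists_smooth_cutoff {x : M} {u : Set M} (hu : u ∈ 𝓝 x) :
    ∃ χ : M → ℝ, ContMDiff 𝓘(ℝ, E) 𝓘(ℝ, ℝ) ∞ χ ∧ (∀ᶠ y in 𝓝 x, χ y = 1) ∧ tsupport χ ⊆ u ∧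
      ∀ y, χ y ≤ 1 := by
  obtain ⟨f, -, hf⟩ := (SmoothBumpFunction.nhds_basis_tsupport (I := 𝓘(ℝ, E)) x).mem_iff.1 hu
  exact ⟨f, f.contMDiff, f.eventuallyEq_one, hf, fun y => f.le_one⟩

/-- The germ of a local smooth section is the germ of a global one. -/
theorem exists_section_eventuallyEq {F : Type*} [NormedAddCommGroup F] [NormedSpace ℝ F]
    {V : M → Type*} [TopologicalSpace (TotalSpace F V)] [∀ x, AddCommGroup (V x)]
    [∀ x, Module ℝ (V x)] [∀ x, TopologicalSpace (V x)] [FiberBundle F V] [VectorBundle ℝ F V]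
    {s : ∀ p, V p} {u : Set M} (hu : IsOpen u)
    (hs : ContMDiffOn 𝓘(ℝ, E) (𝓘(ℝ, E).prod 𝓘(ℝ, F)) ∞ (fun p => TotalSpace.mk' F p (s p)) u)
    {x : M} (hx : x ∈ u) :
    ∃ t : ContMDiffSection 𝓘(ℝ, E) F ∞ V, ∀ᶠ p in 𝓝 x, t p = s p := by
  obtain ⟨χ, hχ, h1, h2, -⟩ := exists_smooth_cutoff (E := E) (hu.mem_nhds hx)
  refine ⟨⟨χ • s, ContMDiffOn.smul_section_of_tsupport hχ.contMDiffOn hu h2 hs⟩, ?_⟩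
  filter_upwards [h1] with p hp
  change χ p • s p = s p
  rw [hp, one_smul]

/-- The germ of a local smooth function is the germ of a global one. -/
theorem exists_function_eventuallyEq {F : Type*} [NormedAddCommGroup F] [NormedSpace ℝ F]
    {f : M → F} {u : Set M} (hu : IsOpen u) (hf : ContMDiffOn 𝓘(ℝ, E) 𝓘(ℝ, F) ∞ f u)
    {x : M} (hx : x ∈ u) :
    ∃ g : M → F, ContMDiff 𝓘(ℝ, E) 𝓘(ℝ, F) ∞ g ∧ ∀ᶠ p in 𝓝 x, g p = f p := by
  obtain ⟨χ, hχ, h1, h2, -⟩ := exists_smooth_cutoff (E := E) (hu.mem_nhds hx)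
  refine ⟨fun p => χ p • f p, contMDiff_of_tsupport fun p hp => ?_, ?_⟩
  · have hpu : p ∈ u := h2 (tsupport_smul_subset_left χ f hp)
    exact (hχ p).smul ((hf p hpu).contMDiffAt (hu.mem_nhds hpu))
  · filter_upwards [h1] with p hp
    rw [hp, one_smul]

namespace LineBundle

variable (L : LineBundle E M)

/-- The fibre coordinate of the preferred trivialization at `x₀`. -/
def coord (x₀ : M) {x : M} (v : L.Fiber x) : ℂ := (trivializationAt ℂ L.Fiber x₀ ⟨x, v⟩).2

variable {L}

theorem coord_smul {x₀ x : M} (hx : x ∈ (trivializationAt ℂ L.Fiber x₀).baseSet) (c : ℂ)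
    (v : L.Fiber x) : L.coord x₀ (c • v) = c * L.coord x₀ v :=
  ((trivializationAt ℂ L.Fiber x₀).linear ℂ hx).map_smul c v

theorem coord_injective {x₀ x : M} (hx : x ∈ (trivializationAt ℂ L.Fiber x₀).baseSet) :
    Function.Injective (fun v : L.Fiber x => L.coord x₀ v) := by
  intro v w h
  have := ((trivializationAt ℂ L.Fiber x₀).linearEquivAt ℂ x hx).injective
  exact this h

theorem coord_ne_zero {x₀ x : M} (hx : x ∈ (trivializationAt ℂ L.Fiber x₀).baseSet)
    {v : L.Fiber x} (hv : v ≠ 0) : L.coord x₀ v ≠ 0 := by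
  have h : L.coord x₀ (0 : L.Fiber x) = 0 := by
    have := coord_smul hx 0 (0 : L.Fiber x)
    simpa using this
  exact fun h' => hv (coord_injective hx (h'.trans h.symm))

theorem eq_smul_of_ne_zero {x : M} {e : L.Fiber x} (he : e ≠ 0) (v : L.Fiber x) :
    ∃ c : ℂ, v = c • e := by
  have hx := FiberBundle.mem_baseSet_trivializationAt' (F := ℂ) (E := L.Fiber) x
  refine ⟨L.coord x v / L.coord x e, coord_injective hx ?_⟩
  change L.coord x v = L.coord x _
  rw [coord_smul hx, div_mul_cancel₀ _ (coord_ne_zero hx he)]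

theorem contMDiffAt_coord (s : L.Sections) (x₀ : M) :
    ContMDiffAt 𝓘(ℝ, E) 𝓘(ℝ, ℂ) ∞ (fun x => L.coord x₀ (s x)) x₀ :=
  (contMDiffAt_section x₀).1 (s.contMDiff x₀)

/-- The frame with constant coordinate 1 in a trivialization, multiplied by a cutoff function equal
to 1 near x. -/
theorem exists_section_ne_zero (L : LineBundle E M) (x : M) : ∃ s : L.Sections, s x ≠ 0 := by
  set e := trivializationAt ℂ L.Fiber x
  have hx : x ∈ e.baseSet := FiberBundle.mem_baseSet_trivializationAt' x
  have h1 : ContMDiffOn 𝓘(ℝ, E) (𝓘(ℝ, E).prod 𝓘(ℝ, ℂ)) ∞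
      (fun p => TotalSpace.mk' ℂ p (e.symm p (1 : ℂ))) e.baseSet := by
    rw [e.contMDiffOn_section_baseSet_iff]
    refine (contMDiffOn_const (c := (1 : ℂ))).congr fun p hp => ?_
    rw [e.apply_mk_symm hp]
  obtain ⟨t, ht⟩ := exists_section_eventuallyEq e.open_baseSet h1 hx
  refine ⟨t, fun h0 => ?_⟩
  have h2 := ht.self_of_nhds
  have h3 := e.apply_mk_symm hx (1 : ℂ)
  rw [← h2, h0] at h3
  have h4 : L.coord x (0 : L.Fiber x) = 0 := by
    have := coord_smul hx 0 (0 : L.Fiber x)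
    simpa using this
  have h5 : L.coord x (0 : L.Fiber x) = 1 := congrArg Prod.snd h3
  exact one_ne_zero (h5.symm.trans h4)

@[simp] theorem mulSection_apply (L : LineBundle E M) (f : C^∞⟮𝓘(ℝ, E), M; 𝓘(ℝ, ℂ), ℂ⟯)
    (s : L.Sections) (x : M) : L.mulSection f s x = f x • s x := rfl

end LineBundle

/-- The value of a connection at a point depends only on the germ of the section. -/
theorem Connection.nabla_congr {L : LineBundle E M} (D : Connection L) {s t : L.Sections} {x : M}
    (h : ∀ᶠ y in 𝓝 x, s y = t y) : D.nabla s x = D.nabla t x := by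
  obtain ⟨χ, hχ, h1, h2, -⟩ := exists_smooth_cutoff (E := E) h
  let f : C^∞⟮𝓘(ℝ, E), M; 𝓘(ℝ, ℂ), ℂ⟯ :=
    ⟨fun y => (χ y : ℂ), Complex.ofRealCLM.contDiff.contMDiff.comp hχ⟩
  have hf : f x = 1 := by
    change (χ x : ℂ) = 1
    rw [h1.self_of_nhds, Complex.ofReal_one]
  -- With the cutoff supported where s and t agree, the two products are the same global section. In
  -- the Leibniz rule at x the df terms coincide as well, since s x = t x, and f x = 1.
  have h3 : L.mulSection f s = L.mulSection f t := by
    ext y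
    change (χ y : ℂ) • s y = (χ y : ℂ) • t y
    by_cases hy : y ∈ tsupport χ
    · rw [show s y = t y from h2 hy]
    · rw [image_eq_zero_of_notMem_tsupport hy, Complex.ofReal_zero, zero_smul, zero_smul]
  refine LinearMap.ext fun v => ?_
  have h4 := (D.leibniz f s x v).symm.trans
    ((congrArg (fun r => D.nabla r x v) h3).trans (D.leibniz f t x v))
  rwa [h.self_of_nhds, hf, one_smul, one_smul, add_right_inj] at h4

namespace HermitianMetric

variable {L : LineBundle E M} (h : HermitianMetric L)

theorem smul_right (x : M) (c : ℂ) (v w : L.Fiber x) :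
    h.inner x v (c • w) = conj c * h.inner x v w := by
  rw [h.conj_symm, h.smul_left, map_mul, ← h.conj_symm]

theorem self_im (x : M) (v : L.Fiber x) : (h.inner x v v).im = 0 :=
  Complex.conj_eq_iff_im.1 (h.conj_symm x v v).symm

theorem zero_left (x : M) (w : L.Fiber x) : h.inner x 0 w = 0 := by
  have := h.smul_left x 0 0 w
  simpa using this

/-- `e` has length one at all points of `U`. -/
def IsUnitOn (e : L.Sections) (U : Opens M) : Prop := ∀ x ∈ U, h.inner x (e x) (e x) = 1

variable {h}

theorem ne_zero_of_inner_self {x : M} {e : L.Fiber x} (he : h.inner x e e = 1) : e ≠ 0 := by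
  rintro rfl
  rw [h.zero_left] at he
  exact zero_ne_one he

theorem eq_inner_smul {x : M} {e : L.Fiber x} (he : h.inner x e e = 1) (v : L.Fiber x) :
    v = h.inner x v e • e := by
  obtain ⟨c, rfl⟩ := LineBundle.eq_smul_of_ne_zero (ne_zero_of_inner_self he) v
  rw [h.smul_left, he, mul_one]

/-- Expansion of v along the unit vector e of a one-dimensional fibre. Every multiplicative cocycle
relation between transition functions comes from this. -/
theorem inner_mul_inner {x : M} {e : L.Fiber x} (he : h.inner x e e = 1) (v w : L.Fiber x) :
    h.inner x v w = h.inner x v e * h.inner x e w := by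
  conv_lhs => rw [eq_inner_smul he v]
  rw [h.smul_left]

variable (h) in
/-- `h(s, t)` as a smooth function. -/
def innerFun (s t : L.Sections) : C^∞⟮𝓘(ℝ, E), M; 𝓘(ℝ, ℂ), ℂ⟯ :=
  ⟨fun x => h.inner x (s x) (t x), h.smooth s t⟩

/-- A section that does not vanish at x is divided by its length. The factor is smooth only where
the section is nonzero, so it is replaced by a global function with the same germ, and length one is
kept only near x. -/
theorem exists_isUnitOn (h : HermitianMetric L) (x : M) :
    ∃ (e : L.Sections) (U : Opens M), x ∈ U ∧ h.IsUnitOn e U := by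
  obtain ⟨s, hs⟩ := LineBundle.exists_section_ne_zero L x
  have hre : ContMDiff 𝓘(ℝ, E) 𝓘(ℝ, ℝ) ∞ (fun y => (h.inner y (s y) (s y)).re) :=
    Complex.reCLM.contDiff.contMDiff.comp (h.smooth s s)
  have hpos : ∀ y, s y ≠ 0 → 0 < (h.inner y (s y) (s y)).re := fun y hy => h.pos y _ hy
  have hopen : IsOpen {y | 0 < (h.inner y (s y) (s y)).re} :=
    isOpen_lt continuous_const hre.continuous
  have hsmooth : ContMDiffOn 𝓘(ℝ, E) 𝓘(ℝ, ℂ) ∞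
      (fun y => (((Real.sqrt (h.inner y (s y) (s y)).re)⁻¹ : ℝ) : ℂ))
      {y | 0 < (h.inner y (s y) (s y)).re} := by
    intro y hy
    have hy' : 0 < (h.inner y (s y) (s y)).re := hy
    have h1 : ContDiffAt ℝ ∞ (fun r : ℝ => (((Real.sqrt r)⁻¹ : ℝ) : ℂ))
        (h.inner y (s y) (s y)).re :=
      Complex.ofRealCLM.contDiff.contDiffAt.comp _
        ((Real.contDiffAt_sqrt hy'.ne').inv (Real.sqrt_pos.2 hy').ne')
    exact (h1.contMDiffAt.comp y (hre y)).contMDiffWithinAt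
  obtain ⟨g, hg, hgeq⟩ := exists_function_eventuallyEq hopen hsmooth (hpos x hs)
  obtain ⟨U, hU, hUo, hxU⟩ := mem_nhds_iff.1 (hgeq.and (hopen.mem_nhds (hpos x hs)))
  refine ⟨L.mulSection ⟨g, hg⟩ s, ⟨U, hUo⟩, hxU, fun y hy => ?_⟩
  obtain ⟨h1, h2⟩ := hU hy
  have h2' : 0 < (h.inner y (s y) (s y)).re := h2
  have h3 : h.inner y (s y) (s y) = ((h.inner y (s y) (s y)).re : ℂ) :=
    Complex.ext rfl (by rw [h.self_im, Complex.ofReal_im])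
  change h.inner y (g y • s y) (g y • s y) = 1
  rw [h.smul_left, h.smul_right, h1, h3, Complex.conj_ofReal, Complex.ofReal_re]
  norm_cast
  have h4 := Real.mul_self_sqrt h2'.le
  have h5 := (Real.sqrt_pos.2 h2').ne'
  field_simp
  rw [sq, h4]

end HermitianMetric

end BundleCalculus

/-! ### Connection forms of unit sections -/

section BundleCalculus

open scoped Topology ComplexConjugate

variable {E : Type*} [NormedAddCommGroup E] [NormedSpace ℝ E] [FiniteDimensional ℝ E]
  {M : Type*} [TopologicalSpace M] [ChartedSpace E M] [IsManifold 𝓘(ℝ, E) ∞ M] [T2Space M]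

variable {L : LineBundle E M} {D : Connection L} {h : HermitianMetric L}

/-- The real connection form of a connection relative to a section of length one. -/
def Connection.unitForm (D : Connection L) (h : HermitianMetric L) (e : L.Sections) :
    Form E M ℝ 1 :=
  Form.ofLinear fun x =>
    haveI : FiniteDimensional ℝ (TangentSpace 𝓘(ℝ, E) x) := inferInstanceAs (FiniteDimensional ℝ E)
    haveI : T2Space (TangentSpace 𝓘(ℝ, E) x) := inferInstanceAs (T2Space E)
    LinearMap.toContinuousLinearMap
      { toFun := fun v => (h.inner x (D.nabla e x v) (e x) / (2 * Real.pi * Complex.I)).re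
        map_add' := fun v w => by
          rw [map_add, h.add_left, add_div, Complex.add_re]
        map_smul' := fun c v => by
          have h1 : D.nabla e x (c • v) = (c : ℂ) • D.nabla e x v := by
            rw [map_smul, Complex.coe_smul]
          rw [h1, h.smul_left, mul_div_assoc, Complex.re_ofReal_mul]
          rfl }

theorem Connection.unitForm_apply (D : Connection L) (h : HermitianMetric L) (e : L.Sections)
    (x : M) (v : TangentSpace 𝓘(ℝ, E) x) :
    D.unitForm h e x ![v] = (h.inner x (D.nabla e x v) (e x) / (2 * Real.pi * Complex.I)).re :=
  rfl

/-- Differentiating h(e, e) = 1 gives c + conj c = 0 for c = h(∇e, e). Hence c/2πi is real, and the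
real part taken in `unitForm` loses nothing. -/
theorem HermitianMetric.IsUnitOn.nabla_eq {e : L.Sections} {U : Opens M} (he : h.IsUnitOn e U)
    (hD : D.IsHermitian h) {x : M} (hx : x ∈ U) (v : TangentSpace 𝓘(ℝ, E) x) :
    D.nabla e x v = (2 * Real.pi * Complex.I * (D.unitForm h e x ![v] : ℝ) : ℂ) • e x := by
  have h1 : (fun y => h.inner y (e y) (e y)) =ᶠ[𝓝 x] fun _ => (1 : ℂ) := by
    filter_upwards [U.2.mem_nhds hx] with y hy using he y hy
  have h2 : mfderiv 𝓘(ℝ, E) 𝓘(ℝ, ℂ) (fun y => h.inner y (e y) (e y)) x = 0 := by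
    rw [h1.mfderiv_eq, mfderiv_const]
    rfl
  have h3 := hD e e x v
  rw [h2] at h3
  set c := h.inner x (D.nabla e x v) (e x) with hc
  have h4 : h.inner x (e x) (D.nabla e x v) = conj c := h.conj_symm _ _ _
  have h5 : c + conj c = 0 := by
    rw [h4] at h3; exact h3.symm
  have h6 : c.re = 0 := by
    have := congrArg Complex.re h5
    simp at this
    linarith
  have h7 : c = 2 * Real.pi * Complex.I * (D.unitForm h e x ![v] : ℝ) := by
    rw [Connection.unitForm_apply, ← hc]
    have h8 : c / (2 * Real.pi * Complex.I) = ((c.im / (2 * Real.pi) : ℝ) : ℂ) := by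
      rw [div_eq_iff Complex.two_pi_I_ne_zero]
      have hpi : (Real.pi : ℂ) ≠ 0 := by exact_mod_cast Real.pi_ne_zero
      push_cast
      field_simp
      apply Complex.ext <;> simp [h6]
    rw [h8, Complex.ofReal_re, ← h8, mul_div_cancel₀ _ Complex.two_pi_I_ne_zero]
  rw [← h7, hc]
  exact HermitianMetric.eq_inner_smul (he x hx) _

/-- A connection is known to be smooth only along global vector fields, so the frame of a chart is
replaced near each point by a global field with the same germ. -/
theorem Connection.smoothOn_unitForm (D : Connection L) (h : HermitianMetric L) (e : L.Sections)
    (U : Opens M) : (D.unitForm h e).SmoothOn U := by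
  refine Form.smoothOn_of_chartFrame fun x₀ w p hp => ContMDiffAt.contMDiffWithinAt ?_
  obtain ⟨X, hX⟩ := exists_section_eventuallyEq (chartAt E x₀).open_source
    (contMDiffOn_chartFrame x₀ w) hp.1
  let t : L.Sections := ⟨fun y => D.nabla e y (X y), D.smooth e X⟩
  have h1 : ContMDiff 𝓘(ℝ, E) 𝓘(ℝ, ℝ) ∞
      (fun y => (h.inner y (t y) (e y) / (2 * Real.pi * Complex.I)).re) := by
    have h2 : ContDiff ℝ ∞ (fun z : ℂ => (z / (2 * Real.pi * Complex.I)).re) :=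
      Complex.reCLM.contDiff.comp (contDiff_id.div_const _)
    exact h2.contMDiff.comp (h.smooth t e)
  refine (h1 p).congr_of_eventuallyEq ?_
  filter_upwards [hX] with y hy
  rw [Connection.unitForm_apply, ← hy]
  rfl

/-- The curvature condition quantifies over complex connection forms. The unit form, viewed with
values in ℂ, is one of them, and injectivity of ℝ → ℂ brings the equation back. -/
theorem Connection.d_unitForm {Θ : Form E M ℝ 2} (hD : D.IsHermitian h) (hΘ : D.HasCurvature Θ)
    {e : L.Sections} {U : Opens M} (he : h.IsUnitOn e U) {x : M} (hx : x ∈ U) :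
    (D.unitForm h e).d x = Θ x := by
  have h1 : D.IsConnectionForm U e ((D.unitForm h e).map Complex.ofRealCLM) := fun y hy =>
    ⟨HermitianMetric.ne_zero_of_inner_self (he y hy), fun v => he.nabla_eq hD hy v⟩
  ext v
  have hv : v = ![v 0, v 1] := by funext i; fin_cases i <;> rfl
  have h2 := hΘ U e _ h1 x hx (v 0) (v 1)
  rw [Form.d_map Complex.ofRealCLM (D.smoothOn_unitForm h e U) hx] at h2
  rw [hv]
  exact Complex.ofReal_injective h2

/-- The derivative of a transition function between sections of length one. -/
theorem Connection.IsHermitian.mfderiv_inner (hD : D.IsHermitian h) {e e' : L.Sections} {x : M}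
    {v : TangentSpace 𝓘(ℝ, E) x} {a a' : ℝ}
    (he : D.nabla e x v = (2 * Real.pi * Complex.I * a : ℂ) • e x)
    (he' : D.nabla e' x v = (2 * Real.pi * Complex.I * a' : ℂ) • e' x) :
    (show ℂ from mfderiv 𝓘(ℝ, E) 𝓘(ℝ, ℂ) (fun y => h.inner y (e' y) (e y)) x v) =
      2 * Real.pi * Complex.I * ((a' - a : ℝ) : ℂ) * h.inner x (e' x) (e x) := by
  rw [hD e' e x v, he, he', h.smul_left, h.smul_right]
  simp only [map_mul, Complex.conj_I, Complex.conj_ofReal, map_ofNat, Complex.ofReal_sub]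
  ring

/-- The connection in terms of a section of length one. -/
theorem HermitianMetric.IsUnitOn.nabla_section {e : L.Sections} {U : Opens M}
    (he : h.IsUnitOn e U) {x : M} (hx : x ∈ U) (s : L.Sections) (v : TangentSpace 𝓘(ℝ, E) x) :
    D.nabla s x v =
      (show ℂ from mfderiv 𝓘(ℝ, E) 𝓘(ℝ, ℂ) (fun y => h.inner y (s y) (e y)) x v) • e x +
        h.inner x (s x) (e x) • D.nabla e x v := by
  have h1 : ∀ᶠ y in 𝓝 x, s y = L.mulSection (h.innerFun s e) e y := by
    filter_upwards [U.2.mem_nhds hx] with y hy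
    exact HermitianMetric.eq_inner_smul (he y hy) _
  rw [D.nabla_congr h1]
  exact D.leibniz _ _ _ _

end BundleCalculus

/-! ### Čech classes, refinements and small coverings -/

section CechComputations

open scoped Topology

variable {M : Type*} [TopologicalSpace M]

theorem delta_apply {A : Type*} [AddCommGroup A] (𝒰 : Cover M) (p : ℕ) (c : Cochain A 𝒰 p)
    (σ : Fin (p + 2) → M) (y : 𝒰.inter σ) :
    delta A 𝒰 p c σ y =
      ∑ k : Fin (p + 2), (-1 : ℤ) ^ (k : ℕ) • c (σ ∘ k.succAbove) (𝒰.face σ k y) := by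
  change LocallyConstant.evalAddMonoidHom y _ = _
  simp only [delta, AddMonoidHom.coe_mk, ZeroHom.coe_mk, map_sum, map_zsmul]
  rfl

/-- A locally constant function whose values are integers. -/
theorem exists_locallyConstant_int {X : Type*} [TopologicalSpace X] {a : X → ℝ}
    (ha : Continuous a) (hz : ∀ x, ∃ n : ℤ, a x = n) :
    ∃ n : LocallyConstant X ℤ, ∀ x, (n x : ℝ) = a x := by
  choose n hn using hz
  have h : Continuous n := by
    rw [Int.isClosedEmbedding_coe_real.isInducing.continuous_iff]
    exact ha.congr hn
  exact ⟨⟨n, (IsLocallyConstant.iff_continuous n).2 h⟩, fun x => (hn x).symm⟩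

open Classical in
theorem cechCoeff_cechClass {A B : Type*} [AddCommGroup A] [AddCommGroup B] (f : A →+ B)
    {𝒰 : Cover M} {p : ℕ} (a : cocycles A 𝒰 (p + 1)) :
    cechCoeff M f p (cechClass a) =
      cechClass (cocycleMap (fun q => Cochain.mapCoeff f 𝒰 q)
        (fun q c => delta_mapCoeff A f 𝒰 q c) (p + 1) a) := by
  unfold cechCoeff cechClass
  rw [AddCommGroup.DirectLimit.map_apply_of]
  rfl

/-- Functoriality of the refinement maps is what allows a class that vanishes in the limit to be
killed on some refinement. -/
instance (A : Type*) [AddCommGroup A] (p : ℕ) :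
    DirectedSystem (fun 𝒰 : Cover M => CoverCech A 𝒰 p) (fun i j h => coverCechRes A p i j h) where
  map_self 𝒰 c := by
    induction c using QuotientAddGroup.induction_on
    rfl
  map_map 𝒰 𝒱 𝒲 h h' c := by
    induction c using QuotientAddGroup.induction_on
    rfl

open Classical in
theorem cechClass_eq_zero {A : Type*} [AddCommGroup A] {𝒰 : Cover M} {p : ℕ}
    {a : cocycles A 𝒰 (p + 1)} (h : cechClass a = 0) :
    ∃ (𝒱 : Cover M) (h𝒱 : 𝒰 ≤ 𝒱) (b : Cochain A 𝒱 p),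
      delta A 𝒱 p b = Cochain.res h𝒱 (p + 1) a := by
  obtain ⟨𝒱, h𝒱, h0⟩ := AddCommGroup.DirectLimit.of.zero_exact _ _ h
  obtain ⟨b, hb⟩ := (QuotientAddGroup.eq_zero_iff _).1 h0
  exact ⟨𝒱, h𝒱, b, hb⟩

open Classical in
theorem cechClass_res {A : Type*} [AddCommGroup A] {𝒰 𝒱 : Cover M} (h : 𝒰 ≤ 𝒱) {p : ℕ}
    (a : cocycles A 𝒰 (p + 1)) :
    cechClass (cocycleMap (fun q => Cochain.res h q) (fun q c => delta_res A h q c) (p + 1) a) =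
      cechClass a :=
  AddCommGroup.DirectLimit.of_f (G := fun 𝒰 : Cover M => CoverCech A 𝒰 p)
    (f := coverCechRes A p) h (QuotientAddGroup.mk a : CoverCech A 𝒰 p)

open Classical in
theorem exists_cechClass_eq {A : Type*} [AddCommGroup A] {p : ℕ} (n : Cech M A p) :
    ∃ (𝒰 : Cover M) (a : cocycles A 𝒰 (p + 1)), n = cechClass a := by
  induction n using AddCommGroup.DirectLimit.induction_on with
  | ih 𝒰 x =>
    induction x using QuotientAddGroup.induction_on with
    | H a => exact ⟨𝒰, a, rfl⟩

open Classical in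
theorem cechClass_sub {A : Type*} [AddCommGroup A] {𝒰 : Cover M} {p : ℕ}
    (a b : cocycles A 𝒰 (p + 1)) :
    cechClass (a - b) = (cechClass a : Cech M A p) + cechClass (-b) := by
  rw [sub_eq_add_neg]
  exact map_add (AddCommGroup.DirectLimit.of (fun 𝒰 : Cover M => CoverCech A 𝒰 p)
    (coverCechRes A p) 𝒰) (QuotientAddGroup.mk a) (QuotientAddGroup.mk (-b))

open Classical in
theorem cechClass_add_neg {A : Type*} [AddCommGroup A] {𝒰 : Cover M} {p : ℕ}
    (b : cocycles A 𝒰 (p + 1)) :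
    (cechClass b : Cech M A p) + cechClass (-b) = 0 := by
  have h := map_add (AddCommGroup.DirectLimit.of (fun 𝒰 : Cover M => CoverCech A 𝒰 p)
    (coverCechRes A p) 𝒰) (QuotientAddGroup.mk b) (QuotientAddGroup.mk (-b))
  refine h.symm.trans ?_
  rw [← QuotientAddGroup.mk_add, add_neg_cancel]
  exact map_zero _

/-- A real cocycle with integral class becomes, on a refinement, an integral cochain plus a
coboundary. -/
theorem exists_integral_cochain {A B : Type*} [AddCommGroup A] [AddCommGroup B] (f : A →+ B)
    {𝒰 : Cover M} {p : ℕ} {a : cocycles B 𝒰 (p + 1)} {n : Cech M A p}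
    (h : cechClass a = cechCoeff M f p n) :
    ∃ (𝒲 : Cover M) (h𝒲 : 𝒰 ≤ 𝒲) (b : Cochain B 𝒲 p) (m : Cochain A 𝒲 (p + 1)),
      delta B 𝒲 p b = Cochain.res h𝒲 (p + 1) a - Cochain.mapCoeff f 𝒲 (p + 1) m := by
  obtain ⟨𝒱, m, rfl⟩ := exists_cechClass_eq n
  obtain ⟨𝒳, hU, hV⟩ := exists_ge_ge 𝒰 𝒱
  rw [cechCoeff_cechClass, ← cechClass_res hU, ← cechClass_res hV] at h
  obtain ⟨𝒲, h𝒲, b, hb⟩ := cechClass_eq_zero ((cechClass_sub _ _).trans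
    ((congrArg (· + _) h).trans (cechClass_add_neg _)))
  exact ⟨𝒲, hU.trans h𝒲, b, Cochain.res (hV.trans h𝒲) (p + 1) m, hb⟩

/-- On a paracompact Hausdorff space there are coverings such that a member which meets another
one lies in the set of a given family that contains the latter. -/
theorem exists_cover_subordinate [ParacompactSpace M] [T2Space M] (W : M → Opens M)
    (hW : ∀ x, x ∈ W x) (N : M → M → M → Set M)
    (hN : ∀ i j x, x ∈ W i → x ∈ W j → N i j x ∈ 𝓝 x) :
    ∃ (𝒰 : Cover M) (i : M → M), (∀ x, 𝒰.U x ≤ W (i x)) ∧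
      ∀ x y, ∀ z ∈ 𝒰.U x, z ∈ 𝒰.U y →
        x ∈ W (i y) ∧ (𝒰.U x : Set M) ⊆ N (i x) (i y) x := by
  obtain ⟨V, hVo, hVc, hVf, hVW⟩ := precise_refinement (fun x => (W x : Set M)) (fun x => (W x).2)
    (Set.iUnion_eq_univ_iff.2 fun x => ⟨x, hW x⟩)
  obtain ⟨V', hVc', hVo', hVV'⟩ := exists_iUnion_eq_closure_subset hVo hVf.point_finite hVc
  choose i hi using fun x => Set.iUnion_eq_univ_iff.1 hVc' x
  have hf : LocallyFinite fun j => closure (V' j) := hVf.subset hVV'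
  have hVW' : ∀ j, closure (V' j) ⊆ W j := fun j => (hVV' j).trans (hVW j)
  -- The neighbourhood of x lies in the chosen set containing x, avoids every closed set of the
  -- shrunken family that does not contain x, and satisfies the condition N for those that do. Local
  -- finiteness makes it a neighbourhood.
  let G : M → Set M := fun x => V' (i x) ∩ (⋂ (j) (_ : x ∉ closure (V' j)), (closure (V' j))ᶜ) ∩
    ⋂ j ∈ {j | x ∈ closure (V' j)}, N (i x) j x
  have hG : ∀ x, G x ∈ 𝓝 x := fun x =>
    Filter.inter_mem (Filter.inter_mem ((hVo' _).mem_nhds (hi x))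
      (hf.iInter_compl_mem_nhds (fun _ => isClosed_closure) x))
      ((Filter.biInter_mem (hf.point_finite x)).2 fun j hj =>
        hN _ _ _ (hVW' _ (subset_closure (hi x))) (hVW' j hj))
  refine ⟨⟨fun x => ⟨interior (G x), isOpen_interior⟩, fun x => mem_interior_iff_mem_nhds.2 (hG x)⟩,
    i, fun x z hz => hVW' _ (subset_closure (interior_subset hz).1.1), fun x y z hx hy => ?_⟩
  -- A common point z lies in `V' (i y)`. Were x outside its closure, the neighbourhood of x would
  -- avoid that closure and could not contain z.
  have h1 : x ∈ closure (V' (i y)) := by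
    by_contra hne
    have h2 := (interior_subset hx).1.2
    simp only [Set.mem_iInter] at h2
    exact h2 (i y) hne (subset_closure (interior_subset hy).1.1)
  refine ⟨hVW' _ h1, fun w hw => ?_⟩
  have h3 := (interior_subset hw).2
  simp only [Set.mem_iInter] at h3
  exact h3 (i y) h1

end CechComputations

/-! ### The exponential t ↦ exp(2πit) and logarithms -/

section Phase

open scoped Topology ComplexConjugate

/-- `t ↦ exp(2πit)`. -/
def phase (t : ℝ) : ℂ := Complex.exp (2 * Real.pi * Complex.I * t)

theorem phase_add (s t : ℝ) : phase (s + t) = phase s * phase t := by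
  rw [phase, phase, phase, ← Complex.exp_add]
  congr 1
  push_cast
  ring

theorem phase_zero : phase 0 = 1 := by simp [phase]

theorem phase_ne_zero (t : ℝ) : phase t ≠ 0 := Complex.exp_ne_zero _

theorem conj_phase (t : ℝ) : conj (phase t) = phase (-t) := by
  rw [phase, phase, ← Complex.exp_conj]
  congr 1
  simp only [map_mul, Complex.conj_I, Complex.conj_ofReal, map_ofNat, Complex.ofReal_neg]
  ring

theorem phase_mul_conj (t : ℝ) : phase t * conj (phase t) = 1 := by
  rw [conj_phase, ← phase_add, add_neg_cancel, phase_zero]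

theorem phase_eq_one_iff (t : ℝ) : phase t = 1 ↔ ∃ n : ℤ, t = n := by
  rw [phase, Complex.exp_eq_one_iff]
  refine exists_congr fun n => ?_
  rw [mul_comm, mul_left_inj' Complex.two_pi_I_ne_zero]
  exact_mod_cast Iff.rfl

theorem hasDerivAt_phase (t : ℝ) :
    HasDerivAt phase (2 * Real.pi * Complex.I * phase t) t := by
  have h1 : HasDerivAt (fun t : ℝ => (2 * Real.pi * Complex.I * t : ℂ))
      (2 * Real.pi * Complex.I) t := by
    simpa using (Complex.ofRealCLM.hasDerivAt (x := t)).const_mul (2 * Real.pi * Complex.I : ℂ)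
  have h2 := (Complex.hasDerivAt_exp _).comp t h1
  exact h2.congr_deriv (mul_comm _ _)

theorem contDiff_phase : ContDiff ℝ ∞ phase :=
  Complex.contDiff_exp.comp (contDiff_const.mul Complex.ofRealCLM.contDiff)

theorem phase_arg {z : ℂ} (hz : ‖z‖ = 1) : phase (Complex.arg z / (2 * Real.pi)) = z := by
  have h := Complex.norm_mul_exp_arg_mul_I z
  rw [hz, Complex.ofReal_one, one_mul] at h
  rw [phase, ← h]
  congr 1
  have hpi : (Real.pi : ℂ) ≠ 0 := by exact_mod_cast Real.pi_ne_zero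
  rw [h]
  push_cast
  field_simp

variable {E : Type*} [NormedAddCommGroup E] [NormedSpace ℝ E]
  {M : Type*} [TopologicalSpace M] [ChartedSpace E M]

theorem mfderiv_phase {f : M → ℝ} {x : M} (hf : MDifferentiableAt 𝓘(ℝ, E) 𝓘(ℝ, ℝ) f x)
    (v : TangentSpace 𝓘(ℝ, E) x) :
    (show ℂ from mfderiv 𝓘(ℝ, E) 𝓘(ℝ, ℂ) (fun y => phase (f y)) x v) =
      2 * Real.pi * Complex.I * ((show ℝ from mfderiv 𝓘(ℝ, E) 𝓘(ℝ, ℝ) f x v : ℝ) : ℂ) *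
        phase (f x) := by
  have h1 := (hasDerivAt_phase (f x)).hasFDerivAt.hasMFDerivAt.comp x hf.hasMFDerivAt
  have h2 := DFunLike.congr_fun h1.mfderiv v
  refine h2.trans ?_
  change (show ℝ from mfderiv 𝓘(ℝ, E) 𝓘(ℝ, ℝ) f x v) • (2 * Real.pi * Complex.I * phase (f x)) = _
  rw [Complex.real_smul]
  ring

/-- A function of modulus one with values near a given one has a logarithm. -/
theorem contMDiffOn_arg {g : M → ℂ} {U : Set M} (hg : ContMDiffOn 𝓘(ℝ, E) 𝓘(ℝ, ℂ) ∞ g U)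
    (h : ∀ y ∈ U, ‖g y - 1‖ < 1) :
    ContMDiffOn 𝓘(ℝ, E) 𝓘(ℝ, ℝ) ∞ (fun y => Complex.arg (g y)) U := by
  intro y hy
  have h1 : g y ∈ Complex.slitPlane := by
    have := Complex.mem_slitPlane_of_norm_lt_one (h y hy)
    simpa using this
  have h2 : ContDiffAt ℝ ∞ (fun z : ℂ => (Complex.log z).im) (g y) :=
    Complex.imCLM.contDiff.contDiffAt.comp _ ((Complex.contDiffAt_log h1).restrict_scalars ℝ)
  simp only [Complex.log_im] at h2
  exact h2.contMDiffAt.comp_contMDiffWithinAt y (hg y hy)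

end Phase

/-! ### A prequantization makes the class integral -/

section IntegralOfPrequantization

open scoped Topology ComplexConjugate

variable {E : Type*} [NormedAddCommGroup E] [NormedSpace ℝ E] [FiniteDimensional ℝ E]
  {M : Type*} [TopologicalSpace M] [ChartedSpace E M] [IsManifold 𝓘(ℝ, E) ∞ M] [T2Space M]

theorem HermitianMetric.norm_inner {L : LineBundle E M} {h : HermitianMetric L} {x : M}
    {e e' : L.Fiber x} (he : h.inner x e e = 1) (he' : h.inner x e' e' = 1) :
    h.inner x e' e * conj (h.inner x e' e) = 1 := by
  rw [← h.conj_symm, ← HermitianMetric.inner_mul_inner he, he']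

theorem norm_eq_one_of_mul_conj {z : ℂ} (hz : z * conj z = 1) : ‖z‖ = 1 := by
  rw [Complex.mul_conj, Complex.normSq_eq_norm_sq] at hz
  have h1 : ‖z‖ ^ 2 = 1 := by exact_mod_cast hz
  exact (pow_eq_one_iff_of_nonneg (norm_nonneg z) two_ne_zero).1 h1

/-- The angle between two unit vectors, chosen near the one at `c`. -/
def angle (g : M → ℂ) (c y : M) : ℝ :=
  (Complex.arg (g y * conj (g c)) + Complex.arg (g c)) / (2 * Real.pi)

theorem phase_angle {g : M → ℂ} {c y : M} (hy : g y * conj (g y) = 1) (hc : g c * conj (g c) = 1) :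
    phase (angle g c y) = g y := by
  have h1 := norm_eq_one_of_mul_conj hy
  have h2 := norm_eq_one_of_mul_conj hc
  rw [angle, add_div, phase_add, phase_arg h2, phase_arg (by
    rw [norm_mul, RCLike.norm_conj, h1, h2, one_mul]), mul_assoc, mul_comm (conj _), hc, mul_one]

/-- The argument is smooth only off the negative axis; dividing by the value at c moves the values
into the disc of radius 1 about 1, where the principal branch is smooth. -/
theorem contMDiffOn_angle {g : M → ℂ} (hg : ContMDiff 𝓘(ℝ, E) 𝓘(ℝ, ℂ) ∞ g) (c : M) {U : Set M}
    (h : ∀ y ∈ U, ‖g y * conj (g c) - 1‖ < 1) :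
    ContMDiffOn 𝓘(ℝ, E) 𝓘(ℝ, ℝ) ∞ (angle g c) U := by
  have h1 : ContDiff ℝ ∞ (fun z : ℂ => z * conj (g c)) := contDiff_id.mul contDiff_const
  have h2 := contMDiffOn_arg (h1.contMDiff.comp hg).contMDiffOn h
  have h3 : ContDiff ℝ ∞ (fun t : ℝ => (t + Complex.arg (g c)) / (2 * Real.pi)) :=
    (contDiff_id.add contDiff_const).div_const _
  exact h3.contMDiff.comp_contMDiffOn h2

theorem SymplecticForm.isIntegralClass_of_prequantization [ParacompactSpace M]
    {Ω : SymplecticForm E M} {hbar : ℝ} (P : Prequantization Ω hbar) :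
    IsIntegralClass (Ω.scaledClass hbar) := by
  obtain ⟨L, h, D, hD, hcurv⟩ := P
  choose e W hxW he using h.exists_isUnitOn
  let g : M → M → M → ℂ := fun i j y => h.inner y (e j y) (e i y)
  have hg : ∀ i j, ContMDiff 𝓘(ℝ, E) 𝓘(ℝ, ℂ) ∞ (g i j) := fun i j => h.smooth (e j) (e i)
  have hgu : ∀ i j y, y ∈ W i → y ∈ W j → g i j y * conj (g i j y) = 1 := fun i j y hi hj =>
    HermitianMetric.norm_inner (he i y hi) (he j y hj)
  -- The prescribed neighbourhoods of x are those on which g_ij, divided by its value at x, stays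
  -- within distance 1 of 1, so that a logarithm exists there.
  obtain ⟨𝒰, i, hUW, hUN⟩ := exists_cover_subordinate W hxW
    (fun i j x => {y | ‖g i j y * conj (g i j x) - 1‖ < 1}) fun i j x hi hj => by
      have hc : Continuous fun y => ‖g i j y * conj (g i j x) - 1‖ :=
        (((hg i j).continuous.mul continuous_const).sub continuous_const).norm
      refine (isOpen_lt hc continuous_const).mem_nhds ?_
      change ‖g i j x * conj (g i j x) - 1‖ < 1
      rw [hgu i j x hi hj, sub_self, norm_zero]
      exact one_pos
  -- The branch for the pair (l, j) is based at the point l. This is meaningful because l lies in `W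
  -- (i j)` as soon as the two members meet.
  let f : M → M → M → ℝ := fun l j => angle (g (i l) (i j)) l
  have hphase : ∀ l j, ∀ y ∈ 𝒰.U l, y ∈ 𝒰.U j → phase (f l j y) = g (i l) (i j) y :=
    fun l j y hl hj => phase_angle (hgu _ _ _ (hUW l hl) (hUW j hj))
      (hgu _ _ _ (hUW l (𝒰.mem l)) (hUN l j y hl hj).1)
  have hf : ∀ l j, ContMDiffOn 𝓘(ℝ, E) 𝓘(ℝ, ℝ) ∞ (f l j) (𝒰.U l ⊓ 𝒰.U j : Opens M) :=
    fun l j => contMDiffOn_angle (hg _ _) l fun y hy => (hUN l j y hy.1 hy.2).2 hy.1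
  let α : M → Form E M ℝ 1 := fun l => D.unitForm h (e (i l))
  have heU : ∀ l, h.IsUnitOn (e (i l)) (𝒰.U l) := fun l y hy => he (i l) y (hUW l hy)
  have hdf : ∀ l j, ∀ y ∈ 𝒰.U l ⊓ 𝒰.U j, ∀ v : TangentSpace 𝓘(ℝ, E) y,
      α j y ![v] - α l y ![v] = mfderiv 𝓘(ℝ, E) 𝓘(ℝ, ℝ) (f l j) y v := by
    intro l j y hy v
    have h1 : (fun z => phase (f l j z)) =ᶠ[𝓝 y] g (i l) (i j) := by
      filter_upwards [(𝒰.U l ⊓ 𝒰.U j).2.mem_nhds hy] with z hz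
      exact hphase l j z hz.1 hz.2
    have h2 := mfderiv_phase ((hf l j).mdifferentiableAt_of_mem_opens hy) v
    have h3 := hD.mfderiv_inner ((heU l).nabla_eq hD hy.1 v) ((heU j).nabla_eq hD hy.2 v)
    have h4 := (DFunLike.congr_fun h1.mfderiv_eq v).symm.trans h2
    rw [hphase l j y hy.1 hy.2] at h4
    have h5 := h3.symm.trans h4
    -- The derivative of g is computed once from the metric and once from its logarithm; cancelling
    -- 2πi g leaves the equation for df.
    have hgne : g (i l) (i j) y ≠ 0 := by
      rw [← hphase l j y hy.1 hy.2]; exact phase_ne_zero _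
    have h6 := mul_left_cancel₀ Complex.two_pi_I_ne_zero (mul_right_cancel₀ hgne h5)
    exact Complex.ofReal_injective h6
  have hcont : ∀ σ : Fin 3 → M, Continuous fun y : 𝒰.inter σ =>
      f (σ 0) (σ 1) y + f (σ 1) (σ 2) y - f (σ 0) (σ 2) y := by
    intro σ
    have hfc : ∀ k m : Fin 3, Continuous fun y : 𝒰.inter σ => f (σ k) (σ m) y := fun k m =>
      (hf (σ k) (σ m)).continuousOn.comp_continuous continuous_subtype_val
        fun y => ⟨y.2 k, y.2 m⟩
    exact ((hfc 0 1).add (hfc 1 2)).sub (hfc 0 2)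
  have hint : ∀ (σ : Fin 3 → M) (y : 𝒰.inter σ), ∃ n : ℤ,
      f (σ 0) (σ 1) y + f (σ 1) (σ 2) y - f (σ 0) (σ 2) y = n := by
    intro σ y
    rw [← phase_eq_one_iff, sub_eq_add_neg, phase_add, phase_add, ← conj_phase,
      hphase _ _ _ (y.2 0) (y.2 1), hphase _ _ _ (y.2 1) (y.2 2), hphase _ _ _ (y.2 0) (y.2 2)]
    have h0 := hUW _ (y.2 0)
    have h1 := hUW _ (y.2 1)
    have h2 := hUW _ (y.2 2)
    have h3 : g (i (σ 0)) (i (σ 1)) y * g (i (σ 1)) (i (σ 2)) y = g (i (σ 0)) (i (σ 2)) y := by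
      rw [mul_comm]
      exact (HermitianMetric.inner_mul_inner (he _ y h1) _ _).symm
    rw [h3]
    exact hgu _ _ _ h0 h2
  choose n hn using fun σ => exists_locallyConstant_int (hcont σ) (hint σ)
  -- After casting to ℝ the integers are the alternating sums of f, for which δ ∘ δ = 0 is a formal
  -- cancellation.
  have hn0 : delta ℤ 𝒰 2 n = 0 := by
    funext σ
    ext y
    apply Int.cast_injective (α := ℝ)
    rw [delta_apply]
    refine (congrArg Int.cast (Fin.sum_univ_four _)).trans ?_
    simp only [Int.cast_add, smul_eq_mul, Int.cast_mul, Int.cast_pow, Int.cast_neg, Int.cast_one, hn]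
    change (-1) ^ 0 * (f (σ 1) (σ 2) y + f (σ 2) (σ 3) y - f (σ 1) (σ 3) y) +
      (-1) ^ 1 * (f (σ 0) (σ 2) y + f (σ 2) (σ 3) y - f (σ 0) (σ 3) y) +
      (-1) ^ 2 * (f (σ 0) (σ 1) y + f (σ 1) (σ 3) y - f (σ 0) (σ 3) y) +
      (-1) ^ 3 * (f (σ 0) (σ 1) y + f (σ 1) (σ 2) y - f (σ 0) (σ 2) y) = ((0 : ℤ) : ℝ)
    push_cast
    ring
  refine ⟨cechClass ⟨n, hn0⟩, Ω.scaled hbar, 𝒰, cocycleMap (fun q => Cochain.mapCoeff _ 𝒰 q)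
    (fun q c => delta_mapCoeff ℤ (Int.castAddHom ℝ) 𝒰 q c) 2 ⟨n, hn0⟩, rfl,
    ⟨α, f, fun l => D.smoothOn_unitForm h _ _, fun l y hy => D.d_unitForm hD hcurv (heU l) hy,
      hf, hdf, fun σ y => hn σ y⟩, (cechCoeff_cechClass _ _).symm⟩

end IntegralOfPrequantization

/-! ### Local potentials from an integral class -/

section LocalData

open scoped Topology ComplexConjugate

variable {E : Type*} [NormedAddCommGroup E] [NormedSpace ℝ E] [FiniteDimensional ℝ E]
  {M : Type*} [TopologicalSpace M] [ChartedSpace E M] [IsManifold 𝓘(ℝ, E) ∞ M]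

/-- Local potentials of a closed 2-form on the members of a covering, with transition functions
whose phases form a cocycle. -/
structure PotentialData (Θ : Form E M ℝ 2) where
  cover : Cover M
  form : M → Form E M ℝ 1
  fn : M → M → M → ℝ
  smooth_form : ∀ l, (form l).SmoothOn (cover.U l)
  d_form : ∀ l, ∀ y ∈ cover.U l, (form l).d y = Θ y
  smooth_fn : ∀ l j,
    ContMDiffOn 𝓘(ℝ, E) 𝓘(ℝ, ℝ) ∞ (fn l j) (cover.U l ⊓ cover.U j : Opens M)
  mfderiv_fn : ∀ l j, ∀ y ∈ cover.U l, y ∈ cover.U j → ∀ v : TangentSpace 𝓘(ℝ, E) y,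
    (show ℝ from mfderiv 𝓘(ℝ, E) 𝓘(ℝ, ℝ) (fn l j) y v) = form j y ![v] - form l y ![v]
  cocycle : ∀ l j k, ∀ y ∈ cover.U l, y ∈ cover.U j → y ∈ cover.U k →
    phase (fn l j y) * phase (fn j k y) = phase (fn l k y)

open Classical in
/-- Extension of a cochain by zero. -/
def Cochain.ext0 {𝒰 : Cover M} {p : ℕ} (b : Cochain ℝ 𝒰 p) (σ : Fin (p + 1) → M) (y : M) : ℝ :=
  if hy : y ∈ 𝒰.inter σ then b σ ⟨y, hy⟩ else 0

theorem Cochain.ext0_of_mem {𝒰 : Cover M} {p : ℕ} (b : Cochain ℝ 𝒰 p) {σ : Fin (p + 1) → M} {y : M}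
    (hy : y ∈ 𝒰.inter σ) : b.ext0 σ y = b σ ⟨y, hy⟩ := dif_pos hy

theorem Cover.isOpen_inter (𝒰 : Cover M) {p : ℕ} (σ : Fin (p + 1) → M) : IsOpen (𝒰.inter σ) := by
  have : 𝒰.inter σ = ⋂ i, (𝒰.U (σ i) : Set M) := by
    ext y; simp [Cover.inter]
  rw [this]
  exact isOpen_iInter_of_finite fun i => (𝒰.U (σ i)).2

theorem Cochain.ext0_eventually_eq {𝒰 : Cover M} {p : ℕ} (b : Cochain ℝ 𝒰 p)
    {σ : Fin (p + 1) → M} {y : M} (hy : y ∈ 𝒰.inter σ) :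
    ∀ᶠ z in 𝓝 y, b.ext0 σ z = b.ext0 σ y := by
  have h1 := (b σ).isLocallyConstant.eventually_eq ⟨y, hy⟩
  rw [nhds_subtype_eq_comap, Filter.eventually_comap] at h1
  filter_upwards [h1, (𝒰.isOpen_inter σ).mem_nhds hy] with z hz hzm
  rw [b.ext0_of_mem hzm, b.ext0_of_mem hy]
  exact hz ⟨z, hzm⟩ rfl

/-- The zig-zag belongs to some Ω' in the class of Θ, with Ω' − Θ = dβ, and its cocycle a satisfies
a − δb = m on a refinement, with m integral. Replacing α_l by α_l − β gives potentials of Θ;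
replacing f by f − b gives alternating sums m, whose phases are 1. The relation between df and the
potentials survives, since β cancels and b is locally constant. -/
theorem IsIntegralClass.exists_potentialData {Θ : closedForms E M 2}
    (h : IsIntegralClass (Submodule.Quotient.mk Θ : DeRham E M 1)) :
    Nonempty (PotentialData (Θ : smoothForms E M 2).1) := by
  obtain ⟨n, Ω', 𝒰, a, hΩ, ⟨α, f, hα, hdα, hf, hdf, ha⟩, hn⟩ := h
  obtain ⟨⟨β, hβ⟩, hβd⟩ := (Submodule.Quotient.eq _).1 hΩ
  have hβd' : β.d = Ω'.1.1 - Θ.1.1 := hβd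
  obtain ⟨𝒲, h𝒲, b, m, hb⟩ := exists_integral_cochain _ hn
  -- Near each point b is constant, so subtracting it affects neither smoothness nor the derivative
  -- of f.
  have hnear : ∀ l j y, y ∈ 𝒲.U l → y ∈ 𝒲.U j → ∀ᶠ z in 𝓝 y, (b.ext0 ![l, j] z = b.ext0 ![l, j] y) :=
    fun l j y hl hj => b.ext0_eventually_eq (σ := ![l, j]) (y := y) fun i => by
      fin_cases i <;> assumption
  have hff : ∀ l j y, y ∈ 𝒲.U l → y ∈ 𝒲.U j → (fun z => f l j z - b.ext0 ![l, j] z) =ᶠ[𝓝 y]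
      fun z => f l j z - b.ext0 ![l, j] y := by
    intro l j y hl hj
    filter_upwards [hnear l j y hl hj] with z hz
    rw [hz]
  have hfs : ∀ l j y, y ∈ 𝒲.U l → y ∈ 𝒲.U j → ContMDiffAt 𝓘(ℝ, E) 𝓘(ℝ, ℝ) ∞ (f l j) y :=
    fun l j y hl hj => (hf l j y ⟨h𝒲 l hl, h𝒲 j hj⟩).contMDiffAt
      ((𝒰.U l ⊓ 𝒰.U j).2.mem_nhds ⟨h𝒲 l hl, h𝒲 j hj⟩)
  refine ⟨⟨𝒲, fun l => α l + (-1 : ℝ) • β, fun l j y => f l j y - b.ext0 ![l, j] y, ?_, ?_, ?_, ?_,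
    ?_⟩⟩
  · exact fun l => ((hα l).mono (h𝒲 l)).add ((Form.SmoothOn.mono hβ le_top).const_smul _)
  · intro l y hy
    rw [Form.d_add_apply (hα l) (hβ.const_smul (-1)) (h𝒲 l hy) trivial, hdα l y (h𝒲 l hy),
      Form.d_smul, hβd']
    change Ω'.1.1 y + (-1 : ℝ) • (Ω'.1.1 y - Θ.1.1 y) = Θ.1.1 y
    module
  · intro l j y hy
    have h1 : ContDiff ℝ ∞ (fun t : ℝ => t - b.ext0 ![l, j] y) := contDiff_id.sub contDiff_const
    exact ((h1.contMDiff.contMDiffAt.comp y (hfs l j y hy.1 hy.2)).congr_of_eventuallyEq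
      (hff l j y hy.1 hy.2)).contMDiffWithinAt
  · intro l j y hl hj v
    have h1 : HasMFDerivAt 𝓘(ℝ, E) 𝓘(ℝ, ℝ) (fun z => f l j z - b.ext0 ![l, j] y) y
        (mfderiv 𝓘(ℝ, E) 𝓘(ℝ, ℝ) (f l j) y) := by
      have h2 := ((hfs l j y hl hj).mdifferentiableAt (by simp)).hasMFDerivAt.sub
        (hasMFDerivAt_const (I := 𝓘(ℝ, E)) (b.ext0 ![l, j] y) y)
      have h3 := sub_zero (mfderiv 𝓘(ℝ, E) 𝓘(ℝ, ℝ) (f l j) y)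
      exact h3 ▸ h2
    rw [(hff l j y hl hj).mfderiv_eq, h1.mfderiv]
    refine (hdf l j y ⟨h𝒲 l hl, h𝒲 j hj⟩ v).symm.trans ?_
    change _ = (α j y ![v] + (-1 : ℝ) • β y ![v]) - (α l y ![v] + (-1 : ℝ) • β y ![v])
    ring
  · intro l j k y hl hj hk
    have hy : y ∈ 𝒲.inter ![l, j, k] := fun i => by fin_cases i <;> assumption
    have h1 := congrArg (fun c : Cochain ℝ 𝒲 2 => c ![l, j, k] ⟨y, hy⟩) hb
    have h2 := delta_apply 𝒲 1 b ![l, j, k] ⟨y, hy⟩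
    have h3 := h2.symm.trans h1
    have e0 : ![l, j, k] ∘ Fin.succAbove 0 = ![j, k] := by
      funext i; fin_cases i <;> rfl
    have e1 : ![l, j, k] ∘ Fin.succAbove 1 = ![l, k] := by
      funext i; fin_cases i <;> rfl
    have e2 : ![l, j, k] ∘ Fin.succAbove 2 = ![l, j] := by
      funext i; fin_cases i <;> rfl
    have h4 : ∀ q : Fin 3, b (![l, j, k] ∘ q.succAbove) (𝒲.face ![l, j, k] q ⟨y, hy⟩) =
        b.ext0 (![l, j, k] ∘ q.succAbove) y := fun q =>
      (b.ext0_of_mem (𝒲.face ![l, j, k] q ⟨y, hy⟩).2).symm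
    -- The faces omitting the indices 0, 1, 2 enter δb with signs +, −, +.
    have h5 : b.ext0 ![j, k] y - b.ext0 ![l, k] y + b.ext0 ![l, j] y =
        f l j y + f j k y - f l k y - (m ![l, j, k] ⟨y, hy⟩ : ℤ) := by
      have h6 := ha ![l, j, k] ⟨y, fun i => h𝒲 _ (hy i)⟩
      refine Eq.trans ?_ (h3.trans (congrArg (· - ((m ![l, j, k] ⟨y, hy⟩ : ℤ) : ℝ)) h6))
      rw [Fin.sum_univ_three, h4, h4, h4, e0, e1, e2]
      simp
      ring
    have h7 : (f l j y - b.ext0 ![l, j] y) + (f j k y - b.ext0 ![j, k] y) =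
        (f l k y - b.ext0 ![l, k] y) + (m ![l, j, k] ⟨y, hy⟩ : ℤ) := by linarith
    rw [← phase_add, h7, phase_add, (phase_eq_one_iff _).2 ⟨_, rfl⟩, mul_one]

end LocalData

/-! ### The real vector bundle underlying a complex one -/

section RestrictScalars

variable {B : Type*} [TopologicalSpace B] {F : Type*}
  [NormedAddCommGroup F] [NormedSpace ℂ F] {V : B → Type*} [TopologicalSpace (TotalSpace F V)]
  [∀ x, AddCommGroup (V x)] [∀ x, Module ℂ (V x)]

theorem isLinear_real_of_complex (e : Trivialization F (π F V)) [he : e.IsLinear ℂ] :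
    e.IsLinear ℝ :=
  ⟨fun b hb => ⟨(e.linear ℂ hb).map_add, fun c v => by
    have := (e.linear ℂ hb).map_smul (c : ℂ) v
    simpa only [Complex.coe_smul] using this⟩⟩

/-- A complex vector bundle is a real vector bundle. -/
theorem vectorBundle_real_of_complex [∀ x, TopologicalSpace (V x)]
    [FiberBundle F V] [VectorBundle ℂ F V] : VectorBundle ℝ F V where
  trivialization_linear' e _ := isLinear_real_of_complex e
  continuousOn_coordChange' e e' _ _ := by
    have := isLinear_real_of_complex e
    have := isLinear_real_of_complex e'
    have h1 := (ContinuousLinearMap.restrictScalarsL ℂ F F ℝ ℝ).continuous.comp_continuousOn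
      (continuousOn_coordChange ℂ e e')
    refine h1.congr fun b hb => ?_
    ext v
    have h2 := Trivialization.coordChangeL_apply (R := ℝ) e e' hb v
    have h3 := Trivialization.coordChangeL_apply (R := ℂ) e e' hb v
    exact h2.trans h3.symm

end RestrictScalars

/-! ### The bundle and its covariant derivative in trivializations -/

section BundleOfPotentials

open scoped Topology ComplexConjugate

variable {E : Type*} [NormedAddCommGroup E] [NormedSpace ℝ E] [FiniteDimensional ℝ E]
  {M : Type*} [TopologicalSpace M] [ChartedSpace E M] [IsManifold 𝓘(ℝ, E) ∞ M]

namespace PotentialData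

variable {Θ : Form E M ℝ 2} (A : PotentialData Θ)

theorem phase_fn_self {l y : M} (hy : y ∈ A.cover.U l) : phase (A.fn l l y) = 1 :=
  mul_left_cancel₀ (phase_ne_zero (A.fn l l y))
    ((A.cocycle l l l y hy hy hy).trans (mul_one _).symm)

theorem contMDiffOn_phase_fn (l j : M) : ContMDiffOn 𝓘(ℝ, E) 𝓘(ℝ, ℂ) ∞
    (fun y => phase (A.fn l j y)) (A.cover.U l ⊓ A.cover.U j : Opens M) :=
  contDiff_phase.contMDiff.comp_contMDiffOn (A.smooth_fn l j)

/-- The bundle with the transition functions `exp (2πi f)`. -/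
def core : VectorBundleCore ℂ M ℂ M where
  baseSet l := A.cover.U l
  isOpen_baseSet l := (A.cover.U l).2
  -- The preferred trivialization at y is the one with index y. The fibre at y is thereby ℂ itself,
  -- and `rep` passes from that trivialization to the one with index l.
  indexAt := id
  mem_baseSet_at := A.cover.mem
  coordChange l j y := phase (A.fn j l y) • ContinuousLinearMap.id ℂ ℂ
  coordChange_self l y hy v := by
    rw [A.phase_fn_self hy, one_smul]
    rfl
  continuousOn_coordChange l j := by
    have h := (A.contMDiffOn_phase_fn j l).continuousOn
    rw [Opens.coe_inf, Set.inter_comm] at h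
    exact h.smul continuousOn_const
  coordChange_comp i j k y hy v := by
    change phase (A.fn k j y) * (phase (A.fn j i y) * v) = phase (A.fn k i y) * v
    rw [← mul_assoc, A.cocycle k j i y hy.2 hy.1.2 hy.1.1]

/-- The line bundle with the transition functions `exp (2πi f)`. -/
def bundle : LineBundle E M where
  Fiber := A.core.Fiber
  realVectorBundle := vectorBundle_real_of_complex
  smooth :=
    haveI : VectorBundle ℝ ℂ A.core.Fiber := vectorBundle_real_of_complex
    { contMDiffOn_coordChangeL := by
        rintro - - ⟨i, rfl⟩ ⟨j, rfl⟩
        have h1 : ContMDiffOn 𝓘(ℝ, E) 𝓘(ℝ, ℂ →L[ℝ] ℂ) ∞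
            (fun y => phase (A.fn j i y) • ContinuousLinearMap.id ℝ ℂ)
            (A.cover.U j ⊓ A.cover.U i : Opens M) := by
          have h2 : ContDiff ℝ ∞ (fun z : ℂ => z • ContinuousLinearMap.id ℝ ℂ) :=
            contDiff_id.smul contDiff_const
          exact h2.contMDiff.comp_contMDiffOn (A.contMDiffOn_phase_fn j i)
        rw [Opens.coe_inf, Set.inter_comm] at h1
        refine h1.congr fun y hy => ?_
        -- The real and complex coordinate changes are the same map of ℂ, so the formula known over
        -- ℂ can be used over ℝ.
        have hi : (A.core.localTriv i).IsLinear ℝ := isLinear_real_of_complex _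
        have hj : (A.core.localTriv j).IsLinear ℝ := isLinear_real_of_complex _
        ext v
        · have h3 := Trivialization.coordChangeL_apply (R := ℝ)
            (A.core.localTriv i) (A.core.localTriv j) hy v
          have h4 := Trivialization.coordChangeL_apply (R := ℂ)
            (A.core.localTriv i) (A.core.localTriv j) hy v
          exact h3.trans (h4.symm.trans (A.core.localTriv_coordChange_eq i j hy v)) }

/-- The local representative of a section over the `l`-th member of the covering. -/
def rep (S : M → ℂ) (l y : M) : ℂ := phase (A.fn l y y) * S y

theorem rep_self (S : M → ℂ) (y : M) : A.rep S y y = S y := by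
  rw [rep, A.phase_fn_self (A.cover.mem y), one_mul]

theorem rep_change (S : M → ℂ) {l j y : M} (hl : y ∈ A.cover.U l) (hj : y ∈ A.cover.U j) :
    A.rep S j y = phase (A.fn j l y) * A.rep S l y := by
  rw [rep, rep, ← mul_assoc, A.cocycle j l y y hj hl (A.cover.mem y)]

/-- Smoothness of a section in terms of its local representatives. -/
def IsSmoothSection (S : M → ℂ) : Prop :=
  ∀ l, ContMDiffOn 𝓘(ℝ, E) 𝓘(ℝ, ℂ) ∞ (A.rep S l) (A.cover.U l)

theorem contMDiff_iff_isSmoothSection (s : ∀ x, A.bundle.Fiber x) :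
    ContMDiff 𝓘(ℝ, E) (𝓘(ℝ, E).prod 𝓘(ℝ, ℂ)) ∞ (fun x => TotalSpace.mk' ℂ x (s x)) ↔
      A.IsSmoothSection (fun x => (s x : ℂ)) := by
  have key : ∀ l, ContMDiffOn 𝓘(ℝ, E) (𝓘(ℝ, E).prod 𝓘(ℝ, ℂ)) ∞
      (fun x => TotalSpace.mk' ℂ x (s x)) (A.cover.U l) ↔
      ContMDiffOn 𝓘(ℝ, E) 𝓘(ℝ, ℂ) ∞ (A.rep (fun x => (s x : ℂ)) l) (A.cover.U l) := fun l =>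
    let e : Trivialization ℂ (π ℂ A.bundle.Fiber) := A.core.localTriv l
    haveI : MemTrivializationAtlas e := ⟨⟨l, rfl⟩⟩
    e.contMDiffOn_section_baseSet_iff
  constructor
  · exact fun h l => (key l).1 h.contMDiffOn
  · exact fun h x => ((key x).2 (h x) x (A.cover.mem x)).contMDiffAt
      ((A.cover.U x).2.mem_nhds (A.cover.mem x))

/-- The covariant derivative of a section in the `l`-th trivialization. -/
def localCov (S : M → ℂ) (l y : M) (v : TangentSpace 𝓘(ℝ, E) y) : ℂ :=
  Form.diff ℂ (A.rep S l) y ![v] +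
    2 * Real.pi * Complex.I * (A.form l y ![v] : ℝ) * A.rep S l y

variable {A}

theorem IsSmoothSection.mdifferentiableAt {S : M → ℂ} (hS : A.IsSmoothSection S) {l y : M}
    (hy : y ∈ A.cover.U l) : MDifferentiableAt 𝓘(ℝ, E) 𝓘(ℝ, ℂ) (A.rep S l) y :=
  (hS l).mdifferentiableAt_of_mem_opens hy

theorem diff_mul {p q : M → ℂ} {y : M} (hp : MDifferentiableAt 𝓘(ℝ, E) 𝓘(ℝ, ℂ) p y)
    (hq : MDifferentiableAt 𝓘(ℝ, E) 𝓘(ℝ, ℂ) q y) (v : TangentSpace 𝓘(ℝ, E) y) :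
    Form.diff ℂ (fun z => p z * q z) y ![v] =
      Form.diff ℂ p y ![v] * q y + p y * Form.diff ℂ q y ![v] := by
  have h := DFunLike.congr_fun (hp.hasMFDerivAt.mul hq.hasMFDerivAt).mfderiv v
  refine h.trans ?_
  change p y * Form.diff ℂ q y ![v] + q y * Form.diff ℂ p y ![v] = _
  ring

theorem diff_congr {F : Type*} [NormedAddCommGroup F] [NormedSpace ℝ F] {p q : M → F} {y : M}
    (h : p =ᶠ[𝓝 y] q) (v : TangentSpace 𝓘(ℝ, E) y) :
    Form.diff F p y ![v] = Form.diff F q y ![v] :=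
  DFunLike.congr_fun h.mfderiv_eq v

theorem contMDiffOn_mul {p q : M → ℂ} {U : Set M} (hp : ContMDiffOn 𝓘(ℝ, E) 𝓘(ℝ, ℂ) ∞ p U)
    (hq : ContMDiffOn 𝓘(ℝ, E) 𝓘(ℝ, ℂ) ∞ q U) :
    ContMDiffOn 𝓘(ℝ, E) 𝓘(ℝ, ℂ) ∞ (fun y => p y * q y) U :=
  (contDiff_mul (𝕜 := ℝ) (𝔸 := ℂ)).contMDiff.comp_contMDiffOn (hp.prodMk_space hq)

/-- Gauge covariance: differentiating the phase in the change of trivialization produces 2πi (α_l −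
α_j), which turns the potential α_j into α_l. -/
theorem IsSmoothSection.localCov_change {S : M → ℂ} (hS : A.IsSmoothSection S) {l j y : M}
    (hl : y ∈ A.cover.U l) (hj : y ∈ A.cover.U j) (v : TangentSpace 𝓘(ℝ, E) y) :
    A.localCov S j y v = phase (A.fn j l y) * A.localCov S l y v := by
  have h1 : A.rep S j =ᶠ[𝓝 y] fun z => phase (A.fn j l z) * A.rep S l z := by
    filter_upwards [(A.cover.U l ⊓ A.cover.U j).2.mem_nhds ⟨hl, hj⟩] with z hz
    exact A.rep_change S hz.1 hz.2
  have h3 : Form.diff ℂ (fun z => phase (A.fn j l z)) y ![v] =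
      2 * Real.pi * Complex.I * ((A.form l y ![v] - A.form j y ![v] : ℝ) : ℂ) *
        phase (A.fn j l y) := by
    rw [← A.mfderiv_fn j l y hj hl v]
    exact mfderiv_phase ((A.smooth_fn j l).mdifferentiableAt_of_mem_opens ⟨hj, hl⟩) v
  rw [localCov, localCov, diff_congr h1,
    diff_mul ((A.contMDiffOn_phase_fn j l).mdifferentiableAt_of_mem_opens ⟨hj, hl⟩)
      (hS.mdifferentiableAt hl), h3, A.rep_change S hl hj]
  push_cast
  ring

/-- The covariant derivative at z is computed in the trivialization with index z, which varies with
z. By covariance it is represented over U_l by one expression in fixed smooth data, whence its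
smoothness. -/
theorem IsSmoothSection.rep_localCov {S : M → ℂ} (hS : A.IsSmoothSection S)
    (X : ∀ y : M, TangentSpace 𝓘(ℝ, E) y) {l y : M} (hl : y ∈ A.cover.U l) :
    A.rep (fun z => A.localCov S z z (X z)) l y = A.localCov S l y (X y) :=
  (hS.localCov_change (A.cover.mem y) hl (X y)).symm

theorem IsSmoothSection.localCov_smooth {S : M → ℂ} (hS : A.IsSmoothSection S)
    (X : ContMDiffSection 𝓘(ℝ, E) E ∞ (TangentSpace 𝓘(ℝ, E) : M → Type _)) :
    A.IsSmoothSection (fun z => A.localCov S z z (X z)) := by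
  intro l
  have h1 := (Form.smoothOn_diff (hS l)).contMDiffOn_apply (X := X) X.contMDiff.contMDiffOn
  have h2 := (A.smooth_form l).contMDiffOn_apply (X := X) X.contMDiff.contMDiffOn
  have h3 : ContDiff ℝ ∞ (fun t : ℝ => (2 * Real.pi * Complex.I * t : ℂ)) :=
    contDiff_const.mul Complex.ofRealCLM.contDiff
  have h4 := h1.add (contMDiffOn_mul (h3.contMDiff.comp_contMDiffOn h2) (hS l))
  exact h4.congr fun y hy => hS.rep_localCov X hy

end PotentialData

end BundleOfPotentials

/-! ### Metric, connection and curvature of the constructed bundle -/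

section PrequantizationOfPotentials

open scoped Topology ComplexConjugate

variable {E : Type*} [NormedAddCommGroup E] [NormedSpace ℝ E] [FiniteDimensional ℝ E]
  {M : Type*} [TopologicalSpace M] [ChartedSpace E M] [IsManifold 𝓘(ℝ, E) ∞ M]

namespace PotentialData

variable {Θ : Form E M ℝ 2} (A : PotentialData Θ)

theorem isSmoothSection (s : A.bundle.Sections) : A.IsSmoothSection (fun y => (s y : ℂ)) :=
  (A.contMDiff_iff_isSmoothSection s).1 s.contMDiff

/-- Transition functions of modulus one preserve the standard hermitian form, so it may be computed
in any trivialization. -/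
theorem rep_mul_conj_rep (S T : M → ℂ) {l y : M} :
    A.rep S l y * conj (A.rep T l y) = S y * conj (T y) := by
  rw [rep, rep, map_mul, mul_mul_mul_comm, phase_mul_conj, one_mul]

/-- The standard hermitian metric in unitary trivializations. -/
def metric : HermitianMetric A.bundle where
  inner x v w := (show ℂ from v) * conj (show ℂ from w)
  add_left x u v w := add_mul (show ℂ from u) (show ℂ from v) _
  smul_left x c v w := mul_assoc c (show ℂ from v) _
  conj_symm x v w := by
    rw [map_mul, Complex.conj_conj, mul_comm]
  pos x v hv := by
    have hv' : (show ℂ from v) ≠ 0 := hv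
    rw [Complex.mul_conj, Complex.ofReal_re]
    exact Complex.normSq_pos.2 hv'
  smooth s t x := by
    have h1 : ContDiff ℝ ∞ (fun p : ℂ × ℂ => p.1 * conj p.2) :=
      contDiff_fst.mul (Complex.conjCLE.contDiff.comp contDiff_snd)
    have h2 := h1.contMDiff.comp_contMDiffOn
      ((A.isSmoothSection s x).prodMk_space (A.isSmoothSection t x))
    refine ((h2 x (A.cover.mem x)).contMDiffAt
      ((A.cover.U x).2.mem_nhds (A.cover.mem x))).congr_of_eventuallyEq
      (Filter.Eventually.of_forall fun y => ?_)
    exact (A.rep_mul_conj_rep (fun y => (s y : ℂ)) (fun y => (t y : ℂ))).symm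

theorem localCov_eq (S : M → ℂ) (l y : M) (v : TangentSpace 𝓘(ℝ, E) y) :
    A.localCov S l y v = (Form.diff ℂ (A.rep S l)).toLinear y v +
      2 * Real.pi * Complex.I * ((A.form l).toLinear y v : ℝ) * A.rep S l y := by
  rw [Form.toLinear_apply, Form.toLinear_apply, localCov]

theorem localCov_add_right (S : M → ℂ) (l y : M) (v w : TangentSpace 𝓘(ℝ, E) y) :
    A.localCov S l y (v + w) = A.localCov S l y v + A.localCov S l y w := by
  simp only [localCov_eq, map_add]
  push_cast
  ring

theorem localCov_smul_right (S : M → ℂ) (l y : M) (c : ℝ) (v : TangentSpace 𝓘(ℝ, E) y) :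
    A.localCov S l y (c • v) = c * A.localCov S l y v := by
  simp only [localCov_eq, map_smul]
  rw [Complex.real_smul, smul_eq_mul]
  push_cast
  ring

variable {A} in
theorem IsSmoothSection.localCov_add {S T : M → ℂ} (hS : A.IsSmoothSection S)
    (hT : A.IsSmoothSection T) {l y : M} (hy : y ∈ A.cover.U l) (v : TangentSpace 𝓘(ℝ, E) y) :
    A.localCov (fun z => S z + T z) l y v = A.localCov S l y v + A.localCov T l y v := by
  have h1 : A.rep (fun z => S z + T z) l = A.rep S l + A.rep T l :=
    funext fun z => mul_add _ _ _
  have h2 : Form.diff ℂ (A.rep S l + A.rep T l) y ![v] =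
      Form.diff ℂ (A.rep S l) y ![v] + Form.diff ℂ (A.rep T l) y ![v] :=
    DFunLike.congr_fun ((hS.mdifferentiableAt hy).hasMFDerivAt.add
      (hT.mdifferentiableAt hy).hasMFDerivAt).mfderiv v
  rw [localCov, localCov, localCov, h1, h2, Pi.add_apply]
  ring

variable {A} in
theorem IsSmoothSection.localCov_mul {S f : M → ℂ} (hS : A.IsSmoothSection S)
    {l y : M} (hy : y ∈ A.cover.U l) (hf : MDifferentiableAt 𝓘(ℝ, E) 𝓘(ℝ, ℂ) f y)
    (v : TangentSpace 𝓘(ℝ, E) y) :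
    A.localCov (fun z => f z * S z) l y v =
      Form.diff ℂ f y ![v] * A.rep S l y + f y * A.localCov S l y v := by
  have h1 : A.rep (fun z => f z * S z) l = fun z => f z * A.rep S l z :=
    funext fun z => mul_left_comm _ _ _
  rw [localCov, localCov, h1, diff_mul hf (hS.mdifferentiableAt hy)]
  ring

variable {A} in
theorem IsSmoothSection.localCov_mul_self {S f : M → ℂ} (hS : A.IsSmoothSection S) (y : M)
    (hf : MDifferentiableAt 𝓘(ℝ, E) 𝓘(ℝ, ℂ) f y) (v : TangentSpace 𝓘(ℝ, E) y) :
    A.localCov (fun z => f z * S z) y y v =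
      Form.diff ℂ f y ![v] * S y + f y * A.localCov S y y v := by
  rw [hS.localCov_mul (A.cover.mem y) hf, A.rep_self]

/-- The connection with the given local potentials. -/
def connection : Connection A.bundle where
  nabla s x :=
    { toFun := fun v => A.localCov (fun y => (s y : ℂ)) x x v
      map_add' := fun v w => A.localCov_add_right _ x x v w
      map_smul' := fun c v => (A.localCov_smul_right (fun y => (s y : ℂ)) x x c v).trans
        (Complex.real_smul (x := c)).symm }
  smooth s X := (A.contMDiff_iff_isSmoothSection _).2 ((A.isSmoothSection s).localCov_smooth X)
  add s t x := LinearMap.ext fun v =>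
    (A.isSmoothSection s).localCov_add (A.isSmoothSection t) (A.cover.mem x) v
  leibniz f s x v := (A.isSmoothSection s).localCov_mul_self x
    ((f.contMDiff x).mdifferentiableAt (by simp)) v

theorem diff_conj {p : M → ℂ} {y : M} (hp : MDifferentiableAt 𝓘(ℝ, E) 𝓘(ℝ, ℂ) p y)
    (v : TangentSpace 𝓘(ℝ, E) y) :
    Form.diff ℂ (fun z => conj (p z)) y ![v] = conj (Form.diff ℂ p y ![v]) := by
  have h := ((Complex.conjCLE : ℂ →L[ℝ] ℂ).hasFDerivAt (x := p y)).hasMFDerivAt.comp y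
    hp.hasMFDerivAt
  exact DFunLike.congr_fun h.mfderiv v

theorem _root_.MDifferentiableAt.conj_complex {p : M → ℂ} {y : M}
    (hp : MDifferentiableAt 𝓘(ℝ, E) 𝓘(ℝ, ℂ) p y) :
    MDifferentiableAt 𝓘(ℝ, E) 𝓘(ℝ, ℂ) (fun z => conj (p z)) y :=
  (((Complex.conjCLE : ℂ →L[ℝ] ℂ).hasFDerivAt (x := p y)).hasMFDerivAt.comp y
    hp.hasMFDerivAt).mdifferentiableAt

variable {A} in
-- The potential is real, so it contributes 2πiα and its conjugate −2πiα, which cancel; what remains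
-- is the product rule.
theorem IsSmoothSection.diff_metric {S T : M → ℂ} (hS : A.IsSmoothSection S)
    (hT : A.IsSmoothSection T) (x : M) (v : TangentSpace 𝓘(ℝ, E) x) :
    Form.diff ℂ (fun y => S y * conj (T y)) x ![v] =
      A.localCov S x x v * conj (T x) + S x * conj (A.localCov T x x v) := by
  have hs := hS.mdifferentiableAt (A.cover.mem x)
  have ht := hT.mdifferentiableAt (A.cover.mem x)
  have h1 : (fun y => S y * conj (T y)) = fun y => A.rep S x y * conj (A.rep T x y) :=
    funext fun y => (A.rep_mul_conj_rep S T).symm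
  rw [h1, diff_mul hs ht.conj_complex, diff_conj ht, localCov, localCov, A.rep_self, A.rep_self]
  simp only [map_add, map_mul, Complex.conj_I, Complex.conj_ofReal, map_ofNat]
  ring

theorem isHermitian_connection : A.connection.IsHermitian A.metric := fun s t x v =>
  (A.isSmoothSection s).diff_metric (A.isSmoothSection t) x v

/-- The local connection forms differ from the potentials by logarithmic differentials. -/
theorem hasCurvature_connection : A.connection.HasCurvature Θ := by
  intro U s β hβ x hx v w
  set S : M → ℂ := fun y => (s y : ℂ) with hS
  set σ : M → ℂ := A.rep S x with hσ
  have hSs : A.IsSmoothSection S := A.isSmoothSection s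
  have hσne : ∀ y ∈ U, σ y ≠ 0 := fun y hy =>
    mul_ne_zero (phase_ne_zero _) (hβ y hy).1
  have hσs : ContMDiffOn 𝓘(ℝ, E) 𝓘(ℝ, ℂ) ∞ σ (A.cover.U x) := hSs x
  -- The equation ∇s = 2πi β s, moved from the trivialization with index y to the fixed one with
  -- index x, says that β is α_x plus the logarithmic differential of σ divided by 2πi.
  have hform : ∀ y ∈ U, y ∈ A.cover.U x → ∀ u : TangentSpace 𝓘(ℝ, E) y,
      Form.diff ℂ σ y ![u] + 2 * Real.pi * Complex.I * (A.form x y ![u] : ℝ) * σ y =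
        2 * Real.pi * Complex.I * β y ![u] * σ y := by
    intro y hy hyx u
    have h1 := hSs.localCov_change (A.cover.mem y) hyx u
    have h2 : A.localCov S y y u = 2 * Real.pi * Complex.I * β y ![u] * S y := (hβ y hy).2 u
    rw [h2] at h1
    refine h1.trans ?_
    rw [hσ, rep]
    ring
  have hcont : ContinuousAt (fun y => σ y / σ x) x :=
    ((hσs.continuousOn).continuousAt ((A.cover.U x).2.mem_nhds (A.cover.mem x))).div_const _
  have hev : ∀ᶠ y in 𝓝 x, σ y / σ x ∈ Complex.slitPlane := by
    refine hcont.eventually (Complex.isOpen_slitPlane.mem_nhds ?_)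
    change σ x / σ x ∈ _
    rw [div_self (hσne x hx)]
    exact Complex.one_mem_slitPlane
  obtain ⟨V₀, hV, hVo, hxV⟩ := mem_nhds_iff.1
    (hev.and ((U ⊓ A.cover.U x).2.mem_nhds ⟨hx, A.cover.mem x⟩))
  let V : Opens M := ⟨V₀, hVo⟩
  -- Dividing by σ x places the values near 1, where the principal logarithm is smooth, so that
  -- d(ell ∘ σ) = dσ/(2πi σ).
  set ell : ℂ → ℂ := fun z => Complex.log (z / σ x) / (2 * Real.pi * Complex.I) with hell
  have hellderiv : ∀ z, z / σ x ∈ Complex.slitPlane →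
      HasDerivAt ell ((z / σ x)⁻¹ * (1 / σ x) / (2 * Real.pi * Complex.I)) z := fun z hz =>
    (((Complex.hasStrictDerivAt_log hz).hasDerivAt.comp z
      ((hasDerivAt_id z).div_const (σ x))).div_const _)
  have hellsmooth : ∀ z, z / σ x ∈ Complex.slitPlane → ContDiffAt ℝ ∞ ell z := fun z hz =>
    (((Complex.contDiffAt_log hz).comp z (contDiffAt_id.div_const _)).div_const _).restrict_scalars ℝ
  have hlam : ContMDiffOn 𝓘(ℝ, E) 𝓘(ℝ, ℂ) ∞ (fun y => ell (σ y)) V := fun y hy =>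
    (hellsmooth _ (hV hy).1).contMDiffAt.comp_contMDiffWithinAt y
      ((hσs y (hV hy).2.2).mono fun z hz => (hV hz).2.2)
  have hdlam : ∀ y ∈ V, ∀ u : TangentSpace 𝓘(ℝ, E) y,
      Form.diff ℂ (fun y => ell (σ y)) y ![u] =
        Form.diff ℂ σ y ![u] / (2 * Real.pi * Complex.I * σ y) := by
    intro y hy u
    have h1 := ((hellderiv _ (hV hy).1).hasFDerivAt.restrictScalars ℝ).hasMFDerivAt.comp y
      (hσs.mdifferentiableAt_of_mem_opens (hV hy).2.2).hasMFDerivAt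
    refine (DFunLike.congr_fun h1.mfderiv u).trans ?_
    change Form.diff ℂ σ y ![u] * ((σ y / σ x)⁻¹ * (1 / σ x) / (2 * Real.pi * Complex.I)) = _
    have h2 := hσne x hx
    have h3 := hσne y (hV hy).2.1
    have h4 := Complex.two_pi_I_ne_zero
    field_simp
  -- No smoothness of β is given; it is inherited from this germ. As d depends only on the germ and
  -- kills the differential, dβ = dα_x follows.
  have hβeq : ∀ᶠ y in 𝓝 x, β y =
      ((A.form x).map Complex.ofRealCLM + Form.diff ℂ (fun y => ell (σ y)) : Form E M ℂ 1) y := by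
    filter_upwards [hVo.mem_nhds hxV] with y hy
    refine Form.ext_one fun u => ?_
    change _ = ((A.form x y ![u] : ℝ) : ℂ) + Form.diff ℂ (fun y => ell (σ y)) y ![u]
    rw [hdlam y hy u]
    have h3 := hσne y (hV hy).2.1
    have h4 := Complex.two_pi_I_ne_zero
    have h5 := hform y (hV hy).2.1 (hV hy).2.2 u
    have h6 : Form.diff ℂ σ y ![u] = (2 * Real.pi * Complex.I * σ y) *
        (β y ![u] - (A.form x y ![u] : ℝ)) := by
      linear_combination h5
    rw [h6, mul_div_cancel_left₀ _ (mul_ne_zero h4 h3)]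
    ring
  rw [Form.d_congr hβeq, Form.d_add_apply ((A.smooth_form x).map Complex.ofRealCLM)
    (Form.smoothOn_diff hlam) (A.cover.mem x) hxV, Form.d_map _ (A.smooth_form x) (A.cover.mem x),
    Form.d_diff hlam hxV, A.d_form x x (A.cover.mem x), add_zero]
  rfl

end PotentialData

theorem SymplecticForm.nonempty_prequantization {Ω : SymplecticForm E M} {hbar : ℝ}
    (h : IsIntegralClass (Ω.scaledClass hbar)) : Nonempty (Prequantization Ω hbar) := by
  obtain ⟨A⟩ := IsIntegralClass.exists_potentialData h
  exact ⟨⟨A.bundle, A.metric, A.connection, A.isHermitian_connection,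
    A.hasCurvature_connection⟩⟩

end PrequantizationOfPotentials

/-! ### Locally constant cocycles and covering spaces -/

section LocallyConstantCocycles

open scoped Topology

/-- Locally constant one-cocycles on a simply connected space are coboundaries. -/
theorem exists_locallyConstant_coboundary {X : Type*} [TopologicalSpace X] [SimplyConnectedSpace X]
    [LocallyPathConnectedSpace X] {G : Type*} [Group G] (W : X → Opens X) (hW : ∀ x, x ∈ W x)
    (c : X → X → X → G)
    (hc : ∀ x y p, p ∈ W x → p ∈ W y → ∀ᶠ q in 𝓝 p, c x y q = c x y p)
    (hcc : ∀ x y z p, p ∈ W x → p ∈ W y → p ∈ W z → c x y p * c y z p = c x z p) :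
    ∃ z : X → X → G, (∀ x, ∀ p ∈ W x, ∀ᶠ q in 𝓝 p, z x q = z x p) ∧
      ∀ x y p, p ∈ W x → p ∈ W y → z x p = c x y p * z y p := by
  -- With G discrete, left multiplication by a locally constant cocycle is continuous, and the
  -- resulting bundle is a covering of X.
  let _ : TopologicalSpace G := ⊥
  have _ : DiscreteTopology G := ⟨rfl⟩
  let Z : FiberBundleCore X X G :=
    { baseSet := fun x => W x
      isOpen_baseSet := fun x => (W x).2
      indexAt := id
      mem_baseSet_at := hW
      coordChange := fun x y p g => c y x p * g
      coordChange_self := fun x p hp g => by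
        have h := hcc x x x p hp hp hp
        rw [mul_eq_left.1 h, one_mul]
      continuousOn_coordChange := fun x y q hq => by
        refine ContinuousAt.continuousWithinAt ?_
        have h1 : ContinuousAt (fun p => c y x p) q.1 :=
          (continuousAt_const (y := c y x q.1)).congr
            ((hc y x q.1 hq.1.2 hq.1.1).mono fun _ h => h.symm)
        exact (h1.comp continuousAt_fst).mul continuousAt_snd
      coordChange_comp := fun x y z p hp g => by
        rw [← mul_assoc, hcc z y x p hp.2 hp.1.2 hp.1.1] }
  obtain ⟨x₀⟩ : Nonempty X := inferInstance
  have hcov : IsCoveringMap (π G Z.Fiber) := FiberBundle.isCoveringMap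
  -- Simple connectivity lets the identity of X be lifted through the covering, giving a continuous
  -- section. Its coordinates in the trivializations are locally constant and form the required
  -- cochain.
  obtain ⟨s, ⟨-, hs⟩, -⟩ := hcov.existsUnique_continuousMap_lifts (ContinuousMap.id X) x₀
    (⟨x₀, (1 : G)⟩ : TotalSpace G Z.Fiber) rfl
  have hs' : ∀ p, (s p).proj = p := fun p => congrFun hs p
  have hz : ∀ x p, (Z.localTriv x (s p)).2 = c x p p * (show G from (s p).2) := fun x p => by
    rw [Z.localTriv_apply]
    change c x (s p).proj (s p).proj * (show G from (s p).2) = _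
    rw [hs']
  refine ⟨fun x p => (Z.localTriv x (s p)).2, fun x p hp => ?_, fun x y p hx hy => ?_⟩
  · have hmem : s p ∈ (Z.localTriv x).source := by
      rw [Z.mem_localTriv_source, hs']
      exact hp
    have h1 : ContinuousAt (fun q => (Z.localTriv x (s q)).2) p :=
      (((Z.localTriv x).continuousOn.continuousAt
        ((Z.localTriv x).open_source.mem_nhds hmem)).comp s.continuous.continuousAt).snd
    exact h1.eventually (p := fun g => g = (Z.localTriv x (s p)).2)
      ((isOpen_discrete {(Z.localTriv x (s p)).2}).mem_nhds rfl)
  · beta_reduce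
    rw [hz, hz, ← mul_assoc, hcc x y p p hx hy (hW p)]

end LocallyConstantCocycles

/-! ### Matching local frames and gluing them -/

section LocalEquivalence

open scoped Topology ComplexConjugate

variable {E : Type*} [NormedAddCommGroup E] [NormedSpace ℝ E] [FiniteDimensional ℝ E]
  {M : Type*} [TopologicalSpace M] [ChartedSpace E M] [IsManifold 𝓘(ℝ, E) ∞ M] [T2Space M]

/-- A smooth function with vanishing derivative is locally constant. -/
theorem eventually_eq_of_mfderiv_eq_zero {F : Type*} [NormedAddCommGroup F] [NormedSpace ℝ F]
    {f : M → F} {U : Opens M} (hf : ContMDiffOn 𝓘(ℝ, E) 𝓘(ℝ, F) ∞ f U)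
    (hd : ∀ p ∈ U, ∀ v : TangentSpace 𝓘(ℝ, E) p, mfderiv 𝓘(ℝ, E) 𝓘(ℝ, F) f p v = 0) {x : M}
    (hx : x ∈ U) : ∀ᶠ y in 𝓝 x, f y = f x := by
  set φ := chartAt E x with hφ
  have hxx : φ.symm (φ x) = x := φ.left_inv (mem_chart_source E x)
  obtain ⟨r, hr, hball⟩ := Metric.isOpen_iff.1 (isOpen_chart_domain x U) (φ x)
    ⟨mem_chart_target E x, by simpa [hφ] using hx⟩
  have hderiv : ∀ z ∈ Metric.ball (φ x) r, HasFDerivAt (f ∘ φ.symm) (0 : E →L[ℝ] F) z := by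
    intro z hz
    have h1 := (hf.mdifferentiableAt_of_mem_opens (hball hz).2).hasMFDerivAt.comp z
      ((mdifferentiable_chartAt x).mdifferentiableAt_symm (hball hz).1).hasMFDerivAt
    refine (hasMFDerivAt_iff_hasFDerivAt.1 h1).congr_fderiv ?_
    ext v
    exact hd _ (hball hz).2 _
  have h2 : ∀ᶠ y in 𝓝 x, φ y ∈ Metric.ball (φ x) r :=
    (φ.continuousAt (mem_chart_source E x)).eventually (Metric.ball_mem_nhds _ hr)
  filter_upwards [h2, φ.open_source.mem_nhds (mem_chart_source E x)] with y hy hys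
  have h3 := Metric.isOpen_ball.is_const_of_fderiv_eq_zero (convex_ball _ _).isPreconnected
    (fun z hz => (hderiv z hz).differentiableAt.differentiableWithinAt)
    (fun z hz => (hderiv z hz).fderiv) hy (Metric.mem_ball_self hr)
  change f (φ.symm (φ y)) = f (φ.symm (φ x)) at h3
  rwa [φ.left_inv hys, hxx] at h3

variable {L L' : LineBundle E M} {D : Connection L} {D' : Connection L'}
  {h : HermitianMetric L} {h' : HermitianMetric L'}

/-- Two hermitian connections with the same curvature have local unit sections with the same
connection form. -/
theorem exists_sections_same_form {Θ : Form E M ℝ 2} (hD : D.IsHermitian h)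
    (hΘ : D.HasCurvature Θ) (hD' : D'.IsHermitian h') (hΘ' : D'.HasCurvature Θ) (x : M) :
    ∃ (e : L.Sections) (e' : L'.Sections) (a : Form E M ℝ 1) (W : Opens M), x ∈ W ∧
      h.IsUnitOn e W ∧ h'.IsUnitOn e' W ∧
      ∀ y ∈ W, ∀ v : TangentSpace 𝓘(ℝ, E) y,
        D.nabla e y v = (2 * Real.pi * Complex.I * (a y ![v] : ℝ) : ℂ) • e y ∧
        D'.nabla e' y v = (2 * Real.pi * Complex.I * (a y ![v] : ℝ) : ℂ) • e' y := by
  obtain ⟨e, U, hxU, he⟩ := h.exists_isUnitOn x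
  obtain ⟨e₀, U', hxU', he₀⟩ := h'.exists_isUnitOn x
  set a := D.unitForm h e
  set a' := D'.unitForm h' e₀
  have hs : (a' + (-1 : ℝ) • a).SmoothOn (U ⊓ U') :=
    (D'.smoothOn_unitForm h' e₀ _).add ((D.smoothOn_unitForm h e _).const_smul _)
  -- Both unit forms have the same exterior derivative, so their difference a' − a is closed and
  -- locally equal to df.
  obtain ⟨W, f, hxW, hWU, hf, hdf⟩ := Form.exists_diff_eq hs (fun y hy => by
    rw [Form.d_add_apply (D'.smoothOn_unitForm h' e₀ U')
      ((D.smoothOn_unitForm h e U).const_smul _) hy.2 hy.1, Form.d_smul,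
      Connection.d_unitForm hD' hΘ' he₀ hy.2]
    change Θ y + (-1 : ℝ) • a.d y = 0
    rw [Connection.d_unitForm hD hΘ he hy.1, neg_one_smul, add_neg_cancel]) ⟨hxU, hxU'⟩
  obtain ⟨g, hg, hgf⟩ := exists_function_eventuallyEq W.2 hf hxW
  obtain ⟨V₀, hV, hVo, hxV⟩ := mem_nhds_iff.1 hgf
  -- Multiplication by exp(−2πi f) subtracts df from the connection form and turns a' into a. The
  -- function g globalises the germ of f.
  let q : C^∞⟮𝓘(ℝ, E), M; 𝓘(ℝ, ℂ), ℂ⟯ :=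
    ⟨fun y => phase (-g y), contDiff_phase.contMDiff.comp (contDiff_neg.contMDiff.comp hg)⟩
  refine ⟨e, L'.mulSection q e₀, a, W ⊓ ⟨V₀, hVo⟩, ⟨hxW, hxV⟩, fun y hy => he y (hWU hy.1).1,
    fun y hy => ?_, fun y hy v => ⟨he.nabla_eq hD (hWU hy.1).1 v, ?_⟩⟩
  · rw [LineBundle.mulSection_apply, h'.smul_left, h'.smul_right, he₀ y (hWU hy.1).2, mul_one]
    exact phase_mul_conj _
  · have h1 : (fun z => -g z) =ᶠ[𝓝 y] fun z => -f z := by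
      filter_upwards [hVo.mem_nhds hy.2] with z hz
      rw [show g z = f z from hV hz]
    have h2 : (show ℝ from mfderiv 𝓘(ℝ, E) 𝓘(ℝ, ℝ) (fun z => -g z) y v) = a y ![v] - a' y ![v] := by
      rw [h1.mfderiv_eq]
      have h3 := DFunLike.congr_fun (hf.mdifferentiableAt_of_mem_opens hy.1).hasMFDerivAt.neg.mfderiv v
      refine h3.trans ?_
      change -(mfderiv 𝓘(ℝ, E) 𝓘(ℝ, ℝ) f y v) = _
      rw [hdf y hy.1 v]
      change -(a' y ![v] + (-1 : ℝ) • a y ![v]) = _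
      rw [smul_eq_mul]
      ring
    have h4 := mfderiv_phase (f := fun z => -g z)
      ((contDiff_neg.contMDiff.comp hg).mdifferentiableAt (by simp) (x := y)) v
    rw [h2] at h4
    have h5 := D'.leibniz q e₀ y v
    refine h5.trans ?_
    have h6 : (show ℂ from mfderiv 𝓘(ℝ, E) 𝓘(ℝ, ℂ) q y v) = _ := h4
    rw [h6, he₀.nabla_eq hD' (hWU hy.1).2 v, LineBundle.mulSection_apply]
    change (2 * Real.pi * Complex.I * ((a y ![v] - a' y ![v] : ℝ) : ℂ) * phase (-g y)) • e₀ y +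
      phase (-g y) • (2 * Real.pi * Complex.I * (a' y ![v] : ℝ) : ℂ) • e₀ y =
      (2 * Real.pi * Complex.I * (a y ![v] : ℝ) : ℂ) • phase (-g y) • e₀ y
    rw [smul_smul, smul_smul, ← add_smul]
    congr 1
    push_cast
    ring

/-- Fibrewise linear maps which are smooth in local frames are smooth. -/
theorem contMDiff_of_frames {φ : ∀ x, L.Fiber x → L'.Fiber x}
    (hφ : ∀ (x : M) (c : ℂ) (v : L.Fiber x), φ x (c • v) = c • φ x v)
    (H : ∀ x, ∃ (e : L.Sections) (e' : L'.Sections), e x ≠ 0 ∧ ∀ᶠ y in 𝓝 x, φ y (e y) = e' y) :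
    ContMDiff (𝓘(ℝ, E).prod 𝓘(ℝ, ℂ)) (𝓘(ℝ, E).prod 𝓘(ℝ, ℂ)) ∞
      (fun p : TotalSpace ℂ L.Fiber => TotalSpace.mk' ℂ p.1 (φ p.1 p.2)) := by
  rintro ⟨x, v⟩
  obtain ⟨e, e', hex, hee⟩ := H x
  have hproj : ContMDiff (𝓘(ℝ, E).prod 𝓘(ℝ, ℂ)) 𝓘(ℝ, E) ∞ (π ℂ L.Fiber) := contMDiff_proj _
  rw [contMDiffAt_totalSpace]
  refine ⟨hproj _, ?_⟩
  have hx := FiberBundle.mem_baseSet_trivializationAt' (F := ℂ) (E := L.Fiber) x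
  have hx' := FiberBundle.mem_baseSet_trivializationAt' (F := ℂ) (E := L'.Fiber) x
  have h1 : ContMDiffAt (𝓘(ℝ, E).prod 𝓘(ℝ, ℂ)) 𝓘(ℝ, ℂ) ∞
      (fun p : TotalSpace ℂ L.Fiber => L.coord x p.2) ⟨x, v⟩ :=
    (contMDiffAt_totalSpace.1 (contMDiffAt_id (I := 𝓘(ℝ, E).prod 𝓘(ℝ, ℂ)) (n := ∞)
      (x := (⟨x, v⟩ : TotalSpace ℂ L.Fiber)))).2
  have h2 : ContMDiffAt (𝓘(ℝ, E).prod 𝓘(ℝ, ℂ)) 𝓘(ℝ, ℂ) ∞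
      (fun p : TotalSpace ℂ L.Fiber => L.coord x (e p.1)) ⟨x, v⟩ :=
    ContMDiffAt.comp (g := fun y => L.coord x (e y)) (f := π ℂ L.Fiber)
      (⟨x, v⟩ : TotalSpace ℂ L.Fiber) (LineBundle.contMDiffAt_coord e x) (hproj _)
  have h3 : ContMDiffAt (𝓘(ℝ, E).prod 𝓘(ℝ, ℂ)) 𝓘(ℝ, ℂ) ∞
      (fun p : TotalSpace ℂ L.Fiber => L'.coord x (e' p.1)) ⟨x, v⟩ :=
    ContMDiffAt.comp (g := fun y => L'.coord x (e' y)) (f := π ℂ L.Fiber)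
      (⟨x, v⟩ : TotalSpace ℂ L.Fiber) (LineBundle.contMDiffAt_coord e' x) (hproj _)
  have hne : L.coord x (e x) ≠ 0 := LineBundle.coord_ne_zero hx hex
  have hdiv : ContDiffAt ℂ ∞ (fun p : ℂ × ℂ × ℂ => p.1 / p.2.1)
      (L.coord x v, L.coord x (e x), L'.coord x (e' x)) :=
    ContDiffAt.fun_div contDiff_fst.contDiffAt (contDiff_fst.comp contDiff_snd).contDiffAt hne
  -- In coordinates the map is w ↦ (w / e) e', smooth where the coordinate of e is nonzero.
  have h4 : ContDiffAt ℝ ∞ (fun p : ℂ × ℂ × ℂ => p.1 / p.2.1 * p.2.2)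
      (L.coord x v, L.coord x (e x), L'.coord x (e' x)) :=
    (hdiv.mul (contDiff_snd.comp contDiff_snd).contDiffAt).restrict_scalars ℝ
  refine (h4.contMDiffAt.comp (⟨x, v⟩ : TotalSpace ℂ L.Fiber)
    (h1.prodMk_space (h2.prodMk_space h3))).congr_of_eventuallyEq ?_
  have hev : ∀ᶠ y in 𝓝 x, φ y (e y) = e' y ∧ L.coord x (e y) ≠ 0 ∧
      y ∈ (trivializationAt ℂ L.Fiber x).baseSet ∧ y ∈ (trivializationAt ℂ L'.Fiber x).baseSet :=
    hee.and (((LineBundle.contMDiffAt_coord e x).continuousAt.eventually_ne hne).and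
      (Filter.Eventually.and ((trivializationAt ℂ L.Fiber x).open_baseSet.mem_nhds hx)
        ((trivializationAt ℂ L'.Fiber x).open_baseSet.mem_nhds hx')))
  filter_upwards [(hproj.continuous.continuousAt (x := ⟨x, v⟩)).eventually hev]
  rintro ⟨y, w⟩ ⟨k1, k2, k3, k4⟩
  have k1' : φ y (e y) = e' y := k1
  have k2' : L.coord x (e y) ≠ 0 := k2
  change L'.coord x (φ y w) = L.coord x w / L.coord x (e y) * L'.coord x (e' y)
  have k5 : w = (L.coord x w / L.coord x (e y)) • e y := by
    refine LineBundle.coord_injective k3 ?_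
    change L.coord x w = L.coord x _
    rw [LineBundle.coord_smul k3, div_mul_cancel₀ _ k2']
  conv_lhs => rw [k5]
  rw [hφ, k1', LineBundle.coord_smul k4]

/-- The isometry of fibres which maps a given unit vector to a given unit vector. -/
def unitEquiv {x : M} {e : L.Fiber x} {e' : L'.Fiber x} (he : h.inner x e e = 1)
    (he' : h'.inner x e' e' = 1) : L.Fiber x ≃ₗ[ℂ] L'.Fiber x where
  toFun v := h.inner x v e • e'
  map_add' v w := by rw [h.add_left, add_smul]
  map_smul' c v := by rw [h.smul_left, mul_smul, RingHom.id_apply]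
  invFun w := h'.inner x w e' • e
  left_inv v := by
    beta_reduce
    rw [h'.smul_left, he', mul_one]
    exact (HermitianMetric.eq_inner_smul he v).symm
  right_inv w := by
    beta_reduce
    rw [h.smul_left, he, mul_one]
    exact (HermitianMetric.eq_inner_smul he' w).symm

/-- Fibrewise isomorphisms which locally identify unit sections with the same connection form
constitute an equivalence. -/
theorem exists_equivalence_of_frames (Φ : ∀ x, L.Fiber x ≃ₗ[ℂ] L'.Fiber x)
    (H : ∀ x, ∃ (e : L.Sections) (e' : L'.Sections) (W : Opens M), x ∈ W ∧ h.IsUnitOn e W ∧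
      h'.IsUnitOn e' W ∧ (∀ y ∈ W, Φ y (e y) = e' y) ∧
      ∀ v : TangentSpace 𝓘(ℝ, E) x, ∃ b : ℂ,
        D.nabla e x v = b • e x ∧ D'.nabla e' x v = b • e' x) :
    ∃ φ : LineBundleIso L L',
      (∀ (x : M) (v w : L.Fiber x),
        h.inner x v w = h'.inner x (φ.equiv x v) (φ.equiv x w)) ∧
      ∀ (s : L.Sections) (x : M) (v : TangentSpace 𝓘(ℝ, E) x),
        D'.nabla (φ.mapSection s) x v = φ.equiv x (D.nabla s x v) := by
  have hmetric : ∀ (x : M) (v w : L.Fiber x), h.inner x v w = h'.inner x (Φ x v) (Φ x w) := by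
    intro x v w
    obtain ⟨e, e', W, hxW, he, he', hee, -⟩ := H x
    have h1 := HermitianMetric.eq_inner_smul (he x hxW) v
    have h2 := HermitianMetric.eq_inner_smul (he x hxW) w
    rw [h1, h2, map_smul, map_smul, hee x hxW, h.smul_left, h.smul_right, h'.smul_left,
      h'.smul_right, he x hxW, he' x hxW]
  refine ⟨⟨Φ, contMDiff_of_frames (fun x => (Φ x).map_smul) fun x => ?_,
    contMDiff_of_frames (fun x => (Φ x).symm.map_smul) fun x => ?_⟩, hmetric, fun s x v => ?_⟩
  · obtain ⟨e, e', W, hxW, he, -, hee, -⟩ := H x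
    refine ⟨e, e', HermitianMetric.ne_zero_of_inner_self (he x hxW), ?_⟩
    filter_upwards [W.2.mem_nhds hxW] with y hy using hee y hy
  · obtain ⟨e, e', W, hxW, -, he', hee, -⟩ := H x
    refine ⟨e', e, HermitianMetric.ne_zero_of_inner_self (he' x hxW), ?_⟩
    filter_upwards [W.2.mem_nhds hxW] with y hy
    rw [← hee y hy, LinearEquiv.symm_apply_apply]
  · obtain ⟨e, e', W, hxW, he, he', hee, hb⟩ := H x
    obtain ⟨b, hb1, hb2⟩ := hb v
    rw [he.nabla_section hxW, hb1, map_add, map_smul, map_smul, map_smul, hee x hxW, ← hb2]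
    -- Near x the image of s is h(s, e) e'. The Leibniz rule for this product matches the expansion
    -- of ∇s along e, because e and e' have the same connection coefficient at x.
    refine (D'.nabla_congr (t := L'.mulSection (h.innerFun s e) e') ?_ ▸
      D'.leibniz (h.innerFun s e) e' x v)
    filter_upwards [W.2.mem_nhds hxW] with y hy
    change Φ y (s y) = h.inner y (s y) (e y) • e' y
    rw [← hee y hy, ← map_smul, ← HermitianMetric.eq_inner_smul (he y hy)]

end LocalEquivalence

/-! ### Uniqueness over a simply connected base -/

section GlobalEquivalence

open scoped Topology ComplexConjugate

variable {E : Type*} [NormedAddCommGroup E] [NormedSpace ℝ E] [FiniteDimensional ℝ E]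
  {M : Type*} [TopologicalSpace M] [ChartedSpace E M] [IsManifold 𝓘(ℝ, E) ∞ M] [T2Space M]

theorem coe_circleExp_arg {z : ℂ} (hz : z * conj z = 1) : (Circle.exp z.arg : ℂ) = z := by
  have h := Complex.norm_mul_exp_arg_mul_I z
  rw [norm_eq_one_of_mul_conj hz, Complex.ofReal_one, one_mul] at h
  rw [Circle.coe_exp, h]

theorem circle_mul_conj (z : Circle) : (z : ℂ) * conj (z : ℂ) = 1 := by
  rw [← Circle.coe_inv_eq_conj, ← Circle.coe_mul, mul_inv_cancel, Circle.coe_one]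

theorem Prequantization.equivalent_of_simplyConnected [SimplyConnectedSpace M]
    {Ω : SymplecticForm E M} {hbar : ℝ} (P P' : Prequantization Ω hbar) : P.Equivalent P' := by
  obtain ⟨L, h, D, hD, hcurv⟩ := P
  obtain ⟨L', h', D', hD', hcurv'⟩ := P'
  have _ : LocallyPathConnectedSpace M := ChartedSpace.locallyPathConnectedSpace E M
  choose e e' a W hxW he he' hDe using exists_sections_same_form hD hcurv hD' hcurv'
  -- The discrepancy of the local equivalences: the map e_y ↦ e'_y sends e_x to g_xy e'_x.
  let g : M → M → M → ℂ := fun x y p =>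
    h.inner p (e x p) (e y p) * h'.inner p (e' y p) (e' x p)
  have hgu : ∀ x y p, p ∈ W x → p ∈ W y → g x y p * conj (g x y p) = 1 := by
    intro x y p hx hy
    have h1 := HermitianMetric.norm_inner (he y p hy) (he x p hx)
    have h2 := HermitianMetric.norm_inner (he' x p hx) (he' y p hy)
    change _ * _ * conj (_ * _) = _
    rw [map_mul, mul_mul_mul_comm, h1, h2, one_mul]
  have hgc : ∀ x y z p, p ∈ W y → g x y p * g y z p = g x z p := by
    intro x y z p hy
    change _ * _ * (_ * _) = h.inner p (e x p) (e z p) * h'.inner p (e' z p) (e' x p)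
    rw [HermitianMetric.inner_mul_inner (he y p hy) (e x p) (e z p),
      HermitianMetric.inner_mul_inner (he' y p hy) (e' z p) (e' x p)]
    ring
  have hgloc : ∀ x y p, p ∈ W x → p ∈ W y → ∀ᶠ q in 𝓝 p, g x y q = g x y p := by
    intro x y p hx hy
    have hs := h.smooth (e x) (e y)
    have hs' := h'.smooth (e' y) (e' x)
    refine eventually_eq_of_mfderiv_eq_zero (U := W x ⊓ W y)
      (PotentialData.contMDiffOn_mul hs.contMDiffOn hs'.contMDiffOn) (fun q hq v => ?_) ⟨hx, hy⟩
    refine (PotentialData.diff_mul ((hs q).mdifferentiableAt (by simp))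
      ((hs' q).mdifferentiableAt (by simp)) v).trans ?_
    -- The two factors have logarithmic derivatives 2πi (a_x − a_y) and 2πi (a_y − a_x), because e_x
    -- and e'_x share the form a_x; hence dg = 0.
    have h1 := hD.mfderiv_inner (hDe y q hq.2 v).1 (hDe x q hq.1 v).1
    have h2 := hD'.mfderiv_inner (hDe x q hq.1 v).2 (hDe y q hq.2 v).2
    have h3 : Form.diff ℂ (fun z => h.inner z (e x z) (e y z)) q ![v] = _ := h1
    have h4 : Form.diff ℂ (fun z => h'.inner z (e' y z) (e' x z)) q ![v] = _ := h2
    rw [h3, h4]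
    refine Eq.trans (b := (0 : ℂ)) ?_ rfl
    push_cast
    ring
  -- Passing through the argument gives circle-valued functions defined everywhere, which equal g
  -- wherever it has modulus one, in particular on overlaps.
  obtain ⟨z, hzloc, hzc⟩ := exists_locallyConstant_coboundary W hxW
    (fun x y p => Circle.exp (g x y p).arg)
    (fun x y p hx hy => (hgloc x y p hx hy).mono fun q hq => congrArg (fun w => Circle.exp w.arg) hq)
    (fun x y w p hx hy hw => by
      apply Circle.ext
      rw [Circle.coe_mul, coe_circleExp_arg (hgu x y p hx hy), coe_circleExp_arg (hgu y w p hy hw),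
        coe_circleExp_arg (hgu x w p hx hw), hgc x y w p hy])
  have hzc' : ∀ x y p, p ∈ W x → p ∈ W y → (z x p : ℂ) = g x y p * z y p := by
    intro x y p hx hy
    rw [hzc x y p hx hy, Circle.coe_mul, coe_circleExp_arg (hgu x y p hx hy)]
  have hunit : ∀ (c : Circle) x p, p ∈ W x →
      h'.inner p ((c : ℂ) • e' x p) ((c : ℂ) • e' x p) = 1 := by
    intro c x p hp
    rw [h'.smul_left, h'.smul_right, he' x p hp, mul_one, circle_mul_conj]
  -- The fibre map at p sends e_p to z_p e'_p. Since z_x = g_xy z_y on overlaps, it also sends e_x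
  -- to z_x e'_x for every x with p in W x.
  let Φ : ∀ p, L.Fiber p ≃ₗ[ℂ] L'.Fiber p := fun p =>
    unitEquiv (he p p (hxW p)) (hunit (z p p) p p (hxW p))
  refine exists_equivalence_of_frames Φ fun x => ?_
  obtain ⟨V₀, hV, hVo, hxV⟩ := mem_nhds_iff.1 (hzloc x x (hxW x))
  -- Near x the function z_x is constant, so it may be replaced by its value there; a constant
  -- factor leaves the connection form unchanged.
  let ζ : C^∞⟮𝓘(ℝ, E), M; 𝓘(ℝ, ℂ), ℂ⟯ := ⟨fun _ => (z x x : ℂ), contMDiff_const⟩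
  refine ⟨e x, L'.mulSection ζ (e' x), W x ⊓ ⟨V₀, hVo⟩, ⟨hxW x, hxV⟩, fun y hy => he x y hy.1,
    fun y hy => hunit (z x x) x y hy.1, fun y hy => ?_, fun v =>
      ⟨_, (hDe x x (hxW x) v).1, ?_⟩⟩
  · change h.inner y (e x y) (e y y) • (z y y : ℂ) • e' y y = (z x x : ℂ) • e' x y
    have h1 : z x y = z x x := hV hy.2
    rw [← h1, hzc' x y y hy.1 (hxW y)]
    conv_lhs => rw [HermitianMetric.eq_inner_smul (he' x y hy.1) (e' y y)]
    rw [smul_smul, smul_smul]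
    congr 1
    change _ = h.inner y (e x y) (e y y) * h'.inner y (e' y y) (e' x y) * _
    ring
  · have h1 := D'.leibniz ζ (e' x) x v
    have h2 : mfderiv 𝓘(ℝ, E) 𝓘(ℝ, ℂ) ζ x = 0 := mfderiv_const
    rw [h2] at h1
    refine h1.trans ?_
    change (0 : ℂ) • _ + _ = _
    rw [zero_smul, zero_add, (hDe x x (hxW x) v).2, smul_comm]
    rfl

end GlobalEquivalence

end Prequantum

end

theorem mainTheorem2 {E : Type*} [NormedAddCommGroup E] [NormedSpace ℝ E] [FiniteDimensional ℝ E]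
    {M : Type*} [TopologicalSpace M] [ChartedSpace E M] [IsManifold 𝓘(ℝ, E) ∞ M]
    [T2Space M] [SecondCountableTopology M]
    (Ω : Prequantum.SymplecticForm E M) (hbar : ℝ) (h_hbar : 0 < hbar) :
    (Nonempty (Prequantum.Prequantization Ω hbar) ↔
      Prequantum.IsIntegralClass (Ω.scaledClass hbar)) ∧
    (SimplyConnectedSpace M →
      ∀ P P' : Prequantum.Prequantization Ω hbar, P.Equivalent P') := by
  -- Together with the Hausdorff and second countability assumptions this yields paracompactness,
  -- which the choice of small coverings needs.
  have : LocallyCompactSpace M := ChartedSpace.locallyCompactSpace E M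
  exact ⟨⟨fun ⟨P⟩ => Prequantum.SymplecticForm.isIntegralClass_of_prequantization P,
    Prequantum.SymplecticForm.nonempty_prequantization⟩,
    fun _ P P' => P.equivalent_of_simplyConnected P'⟩
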